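/- Let $k\ge 0$, let $T^k=(S^1)^k$, and let $\pi:M\to B$ and $\tilde\pi:\tilde M\to B$ be smooth principal $T^k$-bundles over a common (finite-dimensional, Hausdorff, second countable) manifold $B$. Let $H\in\Omega^3(M)$ and $\tilde H\in\Omega^3(\tilde M)$ be closed $T^k$-invariant 3-forms. Let $M\times_B\tilde M$ be the fibre product, with projections $p$ to $M$ and $\tilde p$ to $\tilde M$ and with its action of $T^{2k}=T^k\times T^k$. Suppose that $(M,H)$ and $(\tilde M,\tilde H)$ are T-dual through $F$: that is, $F\in\Omega^2(M\times_B\tilde M)$ is $T^{2k}$-invariant, $$p^*H-\tilde p^*\tilde H=dF,$$ and at every point the pairing $F:\ker \tilde p_*\otimes\ker p_*\to\mathbb R$ is nondegenerate. On $TM\oplus T^*M$ consider the pairing $\langle X+\xi,Y+\eta\rangle=\tfrac12(\eta(X)+\xi(Y))$ and the $H$-twisted Courant bracket $$[X+\xi,Y+\eta]_H=[X,Y]+\mathcal L_X\eta-i_Yd\xi-i_Yi_XH,$$ which is the derived bracket $[v_1,v_2]_H\cdot\rho=[[d_H,v_1],v_2]\cdot\rho$ of $d_H\rho=d\rho+H\wedge\rho$,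 where $(X+\xi)\cdot\rho=i_X\rho+\xi\wedge\rho$; and similarly on $\tilde M$ with $\tilde H$. **Theorem.** For every $c\in M\times_B\tilde M$ and every $X+\xi\in T_{p(c)}M\oplus T^*_{p(c)}M$ there is exactly one $\hat X\in T_c(M\times_B\tilde M)$ with $p_*\hat X=X$ such that the covector $p^*\xi-F(\hat X,\cdot)$ vanishes on $\ker\tilde p_*$. Consequently $p^*\xi-F(\hat X,\cdot)=\tilde p^*\tilde\xi$ for a unique covector $\tilde\xi$, and $$\varphi_c(X+\xi)=\tilde p_*\hat X+\tilde\xi$$ is a linear isomorphism $T_{p(c)}M\oplus T^*_{p(c)}M\to T_{\tilde p(c)}\tilde M\oplus T^*_{\tilde p(c)}\tilde M$ preserving the pairings. On smooth $T^k$-invariant sections the maps $\varphi_c$ induce a well-defined bijection $$\varphi:\Gamma(TM\oplus T^*M)^{T^k}\longrightarrow\Gamma(T\tilde M\oplus T^*\tilde M)^{T^k},\qquad \varphi(v)(\tilde p(c))=\varphi_c(v(p(c)))\ \text{ for all } c,$$ which is an isomorphism of Courant algebroids over $B$: it is $C^\infty(B)$-linear, is compatible with the projections to $TB$, and for all $T^k$-invariant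 sections $v_1,v_2$ the section $[v_1,v_2]_H$ is again smooth and $T^k$-invariant and $$\langle v_1,v_2\rangle=\langle\varphi(v_1),\varphi(v_2)\rangle,\qquad \varphi([v_1,v_2]_H)=[\varphi(v_1),\varphi(v_2)]_{\tilde H},$$ where both sides of the first equation are regarded as functions on $B$. -/

import Mathlib

open Set Bundle
open scoped Manifold ContDiff Topology

noncomputable section

namespace TDuality

/-! ### Differential forms on manifolds -/

section Forms

variable {E : Type*} [NormedAddCommGroup E] [NormedSpace ℝ E] {H : Type*} [TopologicalSpace H]
  (I : ModelWithCorners ℝ E H) {M : Type*} [TopologicalSpace M] [ChartedSpace H M]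
  {E' : Type*} [NormedAddCommGroup E'] [NormedSpace ℝ E'] {H' : Type*} [TopologicalSpace H']
  (I' : ModelWithCorners ℝ E' H') {M' : Type*} [TopologicalSpace M'] [ChartedSpace H' M']

/-- Fields of alternating `n`-linear forms on the tangent spaces of `M` (no smoothness imposed). -/
abbrev DForm (M : Type*) [TopologicalSpace M] [ChartedSpace H M] (n : ℕ) : Type _ :=
  ∀ x : M, TangentSpace I x [⋀^Fin n]→L[ℝ] ℝ

/-- The expression of a form in the preferred chart at `x₀`: its pullback by the inverse chart. -/
def formInChart {n : ℕ} (α : DForm I M n) (x₀ : M) : E → E [⋀^Fin n]→L[ℝ] ℝ := fun y =>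
  (α ((extChartAt I x₀).symm y)).compContinuousLinearMap
    (mfderivWithin 𝓘(ℝ, E) I (extChartAt I x₀).symm (range I) y)

/-- A form is smooth if all its chart expressions are. -/
def IsSmoothForm {n : ℕ} (α : DForm I M n) : Prop :=
  ∀ x₀ : M, ContDiffOn ℝ ∞ (formInChart I α x₀) (extChartAt I x₀).target

/-- The exterior derivative, computed at `x` in the preferred chart at `x`. -/
def mextDeriv {n : ℕ} (α : DForm I M n) : DForm I M (n + 1) := fun x =>
  ContinuousAlternatingMap.compContinuousLinearMap
    (extDerivWithin (formInChart I α x) (range I) (extChartAt I x x))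
    (mfderiv I 𝓘(ℝ, E) (extChartAt I x) x)

/-- The pullback of a form. -/
def pullbackForm {n : ℕ} (f : M → M') (α : DForm I' M' n) : DForm I M n := fun x =>
  (α (f x)).compContinuousLinearMap (mfderiv I I' f x)

/-- The interior product `i_X α = α(X, ·, …, ·)`. -/
def contract {n : ℕ} (X : ∀ x : M, TangentSpace I x) (α : DForm I M (n + 1)) : DForm I M n :=
  fun x => ContinuousAlternatingMap.curryLeft (E := E) (α x) (X x)

/-- The Lie derivative `L_X α = d i_X α + i_X d α` of a form of positive degree. -/
def lieDerivForm {n : ℕ} (X : ∀ x : M, TangentSpace I x) (α : DForm I M (n + 1)) :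
    DForm I M (n + 1) :=
  mextDeriv I (contract I X α) + contract I X (mextDeriv I α)

/-- Invariance of a form under an action of `G`. -/
def IsInvariantForm (G : Type*) [SMul G M] {n : ℕ} (α : DForm I M n) : Prop :=
  ∀ g : G, pullbackForm I I (fun x : M => g • x) α = α

/-- Invariance of a vector field under an action of `G`. -/
def IsInvariantField (G : Type*) [SMul G M] (X : ∀ x : M, TangentSpace I x) : Prop :=
  ∀ (g : G) (x : M), mfderiv I I (fun y : M => g • y) x (X x) = X (g • x)

/-! ### The generalized tangent bundle `TM ⊕ T*M` -/

/-- The fibre of `TM ⊕ T*M` at `x`; covectors are written as alternating 1-forms. -/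
abbrev GenTangent (x : M) : Type _ := TangentSpace I x × (TangentSpace I x [⋀^Fin 1]→L[ℝ] ℝ)

/-- Sections of `TM ⊕ T*M` (no smoothness imposed). -/
abbrev GenSection (M : Type*) [TopologicalSpace M] [ChartedSpace H M] : Type _ :=
  ∀ x : M, GenTangent I x

/-- The natural pairing `⟨X + ξ, Y + η⟩ = (η(X) + ξ(Y)) / 2`. -/
def pairing {x : M} (v w : GenTangent I x) : ℝ :=
  (1 / 2) * (w.2 (fun _ => v.1) + v.2 (fun _ => w.1))

/-- The Courant bracket twisted by a 3-form `h`,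
`[X + ξ, Y + η] = [X, Y] + L_X η - i_Y dξ - i_Y i_X h`.
This is the derived bracket of the operator `d + h ∧`. -/
def courantBracket (h : DForm I M 3) (v w : GenSection I M) : GenSection I M := fun x =>
  (VectorField.mlieBracket I (fun y => (v y).1) (fun y => (w y).1) x,
    lieDerivForm I (fun y => (v y).1) (fun y => (w y).2) x
      - contract I (fun y => (w y).1) (mextDeriv I (fun y => (v y).2)) x
      - contract I (fun y => (w y).1) (contract I (fun y => (v y).1) h) x)

variable {I} in
theorem IsSmoothForm.add {n : ℕ} {α η : DForm I M n} (hα : IsSmoothForm I α)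
    (hη : IsSmoothForm I η) : IsSmoothForm I (α + η) :=
  fun x => (hα x).add (hη x)

variable {I} in
theorem IsSmoothForm.const_smul {n : ℕ} {α : DForm I M n} (a : ℝ) (hα : IsSmoothForm I α) :
    IsSmoothForm I (a • α) :=
  fun x => (hα x).const_smul a

/-- Smooth `G`-invariant sections of `TM ⊕ T*M`. For a principal bundle these are the smooth
sections of the bundle `(TM ⊕ T*M)/G` over the base. -/
def invariantSections (G : Type*) (M : Type*) [TopologicalSpace M] [ChartedSpace H M]
    [IsManifold I ∞ M] [SMul G M] : Submodule ℝ (GenSection I M) where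
  carrier := {v | ContMDiff I I.tangent ∞ (fun x => (⟨x, (v x).1⟩ : TangentBundle I M)) ∧
    IsSmoothForm I (fun x => (v x).2) ∧
    IsInvariantField I G (fun x => (v x).1) ∧ IsInvariantForm I G (fun x => (v x).2)}
  add_mem' := by
    rintro v w ⟨hv1, hv2, hv3, hv4⟩ ⟨hw1, hw2, hw3, hw4⟩
    refine ⟨ContMDiff.add_section hv1 hw1, hv2.add hw2, fun g x => ?_, fun g => ?_⟩
    · have := congrArg₂ (· + ·) (hv3 g x) (hw3 g x)
      simpa using this
    · have := congrArg₂ (· + ·) (hv4 g) (hw4 g)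
      exact this
  zero_mem' := by
    refine ⟨contMDiff_zeroSection ℝ _, fun x => ?_, fun g x => ?_, fun g => ?_⟩
    · exact contDiffOn_const (c := (0 : E [⋀^Fin 1]→L[ℝ] ℝ))
    · simp
    · rfl
  smul_mem' := by
    rintro a v ⟨hv1, hv2, hv3, hv4⟩
    refine ⟨ContMDiff.const_smul_section hv1, hv2.const_smul a, fun g x => ?_, fun g => ?_⟩
    · have := congrArg (a • ·) (hv3 g x)
      simpa using this
    · have := congrArg (a • ·) (hv4 g)
      exact this

end Forms

/-! ### Principal torus bundles -/

section Torus

/-- A finite product of manifolds is a manifold. -/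
instance isManifold_pi {ι : Type*} [Fintype ι] {E : ι → Type*} [∀ i, NormedAddCommGroup (E i)]
    [∀ i, NormedSpace ℝ (E i)] {H : ι → Type*} [∀ i, TopologicalSpace (H i)]
    (I : ∀ i, ModelWithCorners ℝ (E i) (H i)) (M : ι → Type*) [∀ i, TopologicalSpace (M i)]
    [∀ i, ChartedSpace (H i) (M i)] (n : ℕ∞ω) [∀ i, IsManifold (I i) n (M i)] :
    IsManifold (ModelWithCorners.pi I) n (∀ i, M i) := by
  refine isManifold_of_contDiffOn _ _ _ ?_
  rintro _ _ ⟨e, he, rfl⟩ ⟨e', he', rfl⟩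
  rw [contDiffOn_pi]
  intro i
  have h := (contDiffGroupoid n (I i)).compatible (he i (mem_univ i)) (he' i (mem_univ i))
  rw [contDiffGroupoid, mem_groupoid_of_pregroupoid] at h
  refine ContDiffOn.comp h.1 (f := fun x : ∀ i, E i => x i) 
    (ContinuousLinearMap.proj (R := ℝ) (φ := E) i).contDiff.contDiffOn ?_
  rintro x ⟨hx, y, rfl⟩
  exact ⟨⟨hx.1 i (mem_univ i), hx.2 i (mem_univ i)⟩, ⟨y i, rfl⟩⟩

/-- The torus `T^k`, a product of `k` copies of the unit circle. -/
abbrev Torus (k : ℕ) : Type := Fin k → Circle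

/-- The model of `T^k` as a manifold. -/
abbrev torusModel (k : ℕ) : ModelWithCorners ℝ (Fin k → EuclideanSpace ℝ (Fin 1))
    (ModelPi fun _ : Fin k => EuclideanSpace ℝ (Fin 1)) :=
  ModelWithCorners.pi fun _ : Fin k => 𝓡 1

variable (k : ℕ)
  (EB : Type*) [NormedAddCommGroup EB] [NormedSpace ℝ EB]
  (EM : Type*) [NormedAddCommGroup EM] [NormedSpace ℝ EM]
  {B : Type*} [TopologicalSpace B] [ChartedSpace EB B]
  {M : Type*} [TopologicalSpace M] [ChartedSpace EM M] [MulAction (Torus k) M]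

/-- A local trivialization of `pr : M → B` is smooth and equivariant if it is a diffeomorphism onto
its image `U × T^k` and intertwines the action on `M` with translation in `T^k`. -/
def IsPrincipalTrivialization {pr : M → B} (e : Trivialization (Torus k) pr) : Prop :=
  ContMDiffOn 𝓘(ℝ, EM) (𝓘(ℝ, EB).prod (torusModel k)) ∞ e e.source ∧
  ContMDiffOn (𝓘(ℝ, EB).prod (torusModel k)) 𝓘(ℝ, EM) ∞ e.toOpenPartialHomeomorph.symm e.target ∧
  ∀ (t : Torus k), ∀ m ∈ e.source, e (t • m) = ((e m).1, t * (e m).2)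

/-- A smooth principal `T^k`-bundle structure, with total space `M` and base `B`, for the given
action of `T^k` on `M`. -/
structure PrincipalTorusBundle (B : Type*) [TopologicalSpace B] [ChartedSpace EB B]
    (M : Type*) [TopologicalSpace M] [ChartedSpace EM M] [MulAction (Torus k) M] where
  /-- The bundle projection. -/
  proj : M → B
  proj_smul : ∀ (t : Torus k) (m : M), proj (t • m) = proj m
  contMDiff_smul : ContMDiff ((torusModel k).prod 𝓘(ℝ, EM)) 𝓘(ℝ, EM) ∞
    (fun q : Torus k × M => q.1 • q.2)
  exists_trivialization : ∀ b : B, ∃ e : Trivialization (Torus k) proj,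
    b ∈ e.baseSet ∧ IsPrincipalTrivialization k EB EM e

end Torus

/-! ### The correspondence space -/

section Correspondence

variable {k : ℕ}
  {EB : Type*} [NormedAddCommGroup EB] [NormedSpace ℝ EB]
  {EM : Type*} [NormedAddCommGroup EM] [NormedSpace ℝ EM]
  {EM' : Type*} [NormedAddCommGroup EM'] [NormedSpace ℝ EM']
  {B : Type*} [TopologicalSpace B] [ChartedSpace EB B]
  {M : Type*} [TopologicalSpace M] [ChartedSpace EM M] [MulAction (Torus k) M]
  {M' : Type*} [TopologicalSpace M'] [ChartedSpace EM' M'] [MulAction (Torus k) M']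

theorem PrincipalTorusBundle.surjective (P : PrincipalTorusBundle k EB EM B M) :
    Function.Surjective P.proj := by
  intro b
  obtain ⟨e, hb, -⟩ := P.exists_trivialization b
  exact ⟨e.toOpenPartialHomeomorph.symm (b, 1), e.proj_symm_apply' hb⟩

theorem PrincipalTorusBundle.contMDiff_proj (P : PrincipalTorusBundle k EB EM B M) :
    ContMDiff 𝓘(ℝ, EM) 𝓘(ℝ, EB) ∞ P.proj := by
  intro m
  obtain ⟨e, hb, he, -⟩ := P.exists_trivialization (P.proj m)
  have hm : m ∈ e.source := by rwa [e.mem_source]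
  have h : ContMDiffAt 𝓘(ℝ, EM) 𝓘(ℝ, EB) ∞ (fun x => (e x).1) m :=
    contMDiffAt_fst.comp m (he.contMDiffAt (e.open_source.mem_nhds hm))
  refine h.congr_of_eventuallyEq ?_
  filter_upwards [e.open_source.mem_nhds hm] with x hx using (e.coe_fst hx).symm

/-- The correspondence space `M ×_B M'`. -/
@[ext]
structure Correspondence (P : PrincipalTorusBundle k EB EM B M)
    (Q : PrincipalTorusBundle k EB EM' B M') where
  /-- The projection `p : M ×_B M' → M`. -/
  fst : M
  /-- The projection `q : M ×_B M' → M'`. -/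
  snd : M'
  comm : P.proj fst = Q.proj snd

namespace Correspondence

variable {P : PrincipalTorusBundle k EB EM B M} {Q : PrincipalTorusBundle k EB EM' B M'}

/-- The subspace topology from `M × M'`. -/
instance : TopologicalSpace (Correspondence P Q) :=
  TopologicalSpace.induced (fun c => (c.fst, c.snd)) inferInstance

theorem isInducing : Topology.IsInducing (fun c : Correspondence P Q => (c.fst, c.snd)) := ⟨rfl⟩

theorem continuous_fst : Continuous (fst : Correspondence P Q → M) :=
  _root_.continuous_fst.comp isInducing.continuous

theorem continuous_snd : Continuous (snd : Correspondence P Q → M') :=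
  _root_.continuous_snd.comp isInducing.continuous

/-- The action of `T^{2k} = T^k × T^k` on the correspondence space. -/
instance : MulAction (Torus k × Torus k) (Correspondence P Q) where
  smul t c := ⟨t.1 • c.fst, t.2 • c.snd, by rw [P.proj_smul, Q.proj_smul, c.comm]⟩
  one_smul c := Correspondence.ext (one_smul _ _) (one_smul _ _)
  mul_smul s t c := Correspondence.ext (mul_smul _ _ _) (mul_smul _ _ _)

open Classical in
/-- The point of `M'` over `b` with coordinate `t` in the trivialization `e` (an arbitrary point
over `b` if `b` is outside the domain of `e`). -/
def pointOver (e : Trivialization (Torus k) Q.proj) (b : B) (t : Torus k) : M' :=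
  if b ∈ e.baseSet then e.toOpenPartialHomeomorph.symm (b, t) else (Q.surjective b).choose

theorem pointOver_of_mem (e : Trivialization (Torus k) Q.proj) {b : B} (hb : b ∈ e.baseSet)
    (t : Torus k) : pointOver e b t = e.toOpenPartialHomeomorph.symm (b, t) := if_pos hb

theorem proj_pointOver (e : Trivialization (Torus k) Q.proj) (b : B) (t : Torus k) :
    Q.proj (pointOver e b t) = b := by
  by_cases hb : b ∈ e.baseSet
  · rw [pointOver_of_mem e hb, e.proj_symm_apply' hb]
  · rw [pointOver, if_neg hb, (Q.surjective b).choose_spec]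

/-- A trivialization `e` of `M'` over `U` identifies the part of `M ×_B M'` over `U` with
`M|_U × T^k`, by `(m, m') ↦ (m, pr₂ (e m'))`. -/
def localTriv (P : PrincipalTorusBundle k EB EM B M) {Q : PrincipalTorusBundle k EB EM' B M'}
    (e : Trivialization (Torus k) Q.proj) :
    OpenPartialHomeomorph (Correspondence P Q) (M × Torus k) where
  toFun c := (c.fst, (e c.snd).2)
  invFun q := ⟨q.1, pointOver e (P.proj q.1) q.2, (proj_pointOver e _ _).symm⟩
  source := {c | Q.proj c.snd ∈ e.baseSet}
  target := {q | P.proj q.1 ∈ e.baseSet}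
  map_source' c hc := by
    change P.proj c.fst ∈ e.baseSet
    rw [c.comm]
    exact hc
  map_target' q hq := by
    change Q.proj (pointOver e (P.proj q.1) q.2) ∈ e.baseSet
    rw [proj_pointOver]
    exact hq
  left_inv' c hc := by
    have hc' : Q.proj c.snd ∈ e.baseSet := hc
    refine Correspondence.ext rfl ?_
    change pointOver e (P.proj c.fst) (e c.snd).2 = c.snd
    rw [c.comm, pointOver_of_mem e hc']
    exact e.symm_apply_mk_proj (e.mem_source.2 hc')
  right_inv' q hq := by
    have hq' : P.proj q.1 ∈ e.baseSet := hq
    refine Prod.ext rfl ?_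
    change (e (pointOver e (P.proj q.1) q.2)).2 = q.2
    rw [pointOver_of_mem e hq', e.apply_symm_apply' hq']
  open_source := e.open_baseSet.preimage (Q.contMDiff_proj.continuous.comp continuous_snd)
  open_target := e.open_baseSet.preimage (P.contMDiff_proj.continuous.comp _root_.continuous_fst)
  continuousOn_toFun := by
    refine ContinuousOn.prodMk continuous_fst.continuousOn ?_
    exact _root_.continuous_snd.comp_continuousOn
      (e.toOpenPartialHomeomorph.continuousOn.comp continuous_snd.continuousOn
        fun c hc => e.mem_source.2 hc)
  continuousOn_invFun := by
    refine isInducing.continuousOn_iff.2 ?_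
    have h : ContinuousOn (fun q : M × Torus k =>
        (q.1, e.toOpenPartialHomeomorph.symm (P.proj q.1, q.2))) {q | P.proj q.1 ∈ e.baseSet} := by
      refine _root_.continuous_fst.continuousOn.prodMk ?_
      refine e.toOpenPartialHomeomorph.continuousOn_symm.comp
        ((P.contMDiff_proj.continuous.comp _root_.continuous_fst).prodMk
          _root_.continuous_snd).continuousOn ?_
      intro q hq
      exact e.mem_target.2 hq
    refine h.congr fun q hq => ?_
    exact Prod.ext rfl (pointOver_of_mem e hq q.2)

/-- The smooth structure of the correspondence space: its charts are the charts of the products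
`M × T^k`, transported by the local identifications `localTriv`. -/
instance : ChartedSpace (ModelProd EM (ModelPi fun _ : Fin k => EuclideanSpace ℝ (Fin 1)))
    (Correspondence P Q) where
  atlas := {f | ∃ e : Trivialization (Torus k) Q.proj, IsPrincipalTrivialization k EB EM' e ∧
    ∃ χ ∈ atlas (ModelProd EM (ModelPi fun _ : Fin k => EuclideanSpace ℝ (Fin 1))) (M × Torus k),
      f = (localTriv P e).trans χ}
  chartAt c := (localTriv P (Q.exists_trivialization (Q.proj c.snd)).choose).trans
    (chartAt (ModelProd EM (ModelPi fun _ : Fin k => EuclideanSpace ℝ (Fin 1)))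
      (localTriv P (Q.exists_trivialization (Q.proj c.snd)).choose c))
  mem_chart_source c := by
    rw [OpenPartialHomeomorph.trans_source]
    exact ⟨(Q.exists_trivialization (Q.proj c.snd)).choose_spec.1, 
      mem_chart_source (ModelProd EM (ModelPi fun _ : Fin k => EuclideanSpace ℝ (Fin 1)))
        (localTriv P (Q.exists_trivialization (Q.proj c.snd)).choose c)⟩
  chart_mem_atlas c := ⟨_, (Q.exists_trivialization (Q.proj c.snd)).choose_spec.2, _,
    chart_mem_atlas _ _, rfl⟩

end Correspondence

/-- The model with corners of the correspondence space. -/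
abbrev corrModel (k : ℕ) (EM : Type*) [NormedAddCommGroup EM] [NormedSpace ℝ EM] :
    ModelWithCorners ℝ (EM × (Fin k → EuclideanSpace ℝ (Fin 1)))
      (ModelProd EM (ModelPi fun _ : Fin k => EuclideanSpace ℝ (Fin 1))) :=
  𝓘(ℝ, EM).prod (torusModel k)

namespace Correspondence

variable {P : PrincipalTorusBundle k EB EM B M} {Q : PrincipalTorusBundle k EB EM' B M'}

theorem contMDiffOn_localTriv_trans {e e' : Trivialization (Torus k) Q.proj}
    (he : IsPrincipalTrivialization k EB EM' e) (he' : IsPrincipalTrivialization k EB EM' e') :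
    ContMDiffOn (corrModel k EM) (corrModel k EM) ∞
      (localTriv P e' ∘ (localTriv P e).symm)
      ((localTriv P e).symm.trans (localTriv P e')).source := by
  have key : ∀ q ∈ ((localTriv P e).symm.trans (localTriv P e')).source,
      P.proj q.1 ∈ e.baseSet ∧ P.proj q.1 ∈ e'.baseSet := by
    intro q hq
    rw [OpenPartialHomeomorph.trans_source] at hq
    refine ⟨hq.1, ?_⟩
    have h2 : Q.proj (pointOver e (P.proj q.1) q.2) ∈ e'.baseSet := hq.2
    rwa [proj_pointOver] at h2
  have hsm : ContMDiffOn (corrModel k EM) (𝓘(ℝ, EB).prod (torusModel k)) ∞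
      (fun q : M × Torus k => (P.proj q.1, q.2))
      ((localTriv P e).symm.trans (localTriv P e')).source :=
    ((P.contMDiff_proj.comp contMDiff_fst).prodMk contMDiff_snd).contMDiffOn
  have h1 : ContMDiffOn (corrModel k EM) 𝓘(ℝ, EM') ∞
      (fun q : M × Torus k => e.toOpenPartialHomeomorph.symm (P.proj q.1, q.2))
      ((localTriv P e).symm.trans (localTriv P e')).source :=
    he.2.1.comp hsm fun q hq => e.mem_target.2 (key q hq).1
  have h2 : ContMDiffOn (corrModel k EM) (𝓘(ℝ, EB).prod (torusModel k)) ∞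
      (fun q : M × Torus k => e' (e.toOpenPartialHomeomorph.symm (P.proj q.1, q.2)))
      ((localTriv P e).symm.trans (localTriv P e')).source := by
    refine he'.1.comp h1 fun q hq => e'.mem_source.2 ?_
    rw [e.proj_symm_apply' (key q hq).1]
    exact (key q hq).2
  have h3 : ContMDiffOn (corrModel k EM) (torusModel k) ∞
      (fun q : M × Torus k => (e' (e.toOpenPartialHomeomorph.symm (P.proj q.1, q.2))).2)
      ((localTriv P e).symm.trans (localTriv P e')).source :=
    fun q hq => contMDiffAt_snd.comp_contMDiffWithinAt q (h2 q hq)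
  refine (contMDiff_fst.contMDiffOn.prodMk h3).congr fun q hq => ?_
  refine Prod.ext rfl ?_
  change (e' (pointOver e (P.proj q.1) q.2)).2 = _
  rw [pointOver_of_mem e (key q hq).1]

instance [IsManifold 𝓘(ℝ, EM) ∞ M] : IsManifold (corrModel k EM) ∞ (Correspondence P Q) := by
  refine isManifold_of_contDiffOn _ _ _ ?_
  rintro _ _ ⟨e, he, χ, hχ, rfl⟩ ⟨e', he', χ', hχ', rfl⟩
  rw [← contMDiffOn_iff_contDiffOn]
  have h1 := contMDiffOn_of_mem_maximalAtlas (I := corrModel k EM) (n := ∞)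
    (IsManifold.subset_maximalAtlas hχ')
  have h2 := contMDiffOn_symm_of_mem_maximalAtlas (I := corrModel k EM) (n := ∞)
    (IsManifold.subset_maximalAtlas hχ)
  have h3 := contMDiffOn_localTriv_trans (P := P) he he'
  have h4 : ContMDiffOn (corrModel k EM) (corrModel k EM) ∞
      (χ' ∘ (localTriv P e' ∘ (localTriv P e).symm) ∘ χ.symm)
      (((localTriv P e).trans χ).symm.trans ((localTriv P e').trans χ')).source := by
    refine h1.comp (h3.comp (h2.mono fun y hy => hy.1.1) ?_) ?_
    · exact fun y hy => ⟨hy.1.2, hy.2.1⟩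
    · exact fun y hy => hy.2.2
  refine (corrModel k EM).contMDiff.contMDiffOn.comp (t := univ) ?_ fun _ _ => mem_univ _
  exact h4.comp ((corrModel k EM).contMDiffOn_symm.mono inter_subset_right) fun x hx => hx.1

/-- The identifications `localTriv` are smooth, hence so are the projections below: the smooth
structure is the usual one. -/
theorem contMDiffOn_localTriv [IsManifold 𝓘(ℝ, EM) ∞ M] {e : Trivialization (Torus k) Q.proj}
    (he : IsPrincipalTrivialization k EB EM' e) :
    ContMDiffOn (corrModel k EM) (corrModel k EM) ∞ (localTriv P e) (localTriv P e).source := by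
  intro c hc
  set χ := chartAt (ModelProd EM (ModelPi fun _ : Fin k => EuclideanSpace ℝ (Fin 1)))
    (localTriv P e c) with hχ
  have hat : χ ∈ atlas (ModelProd EM (ModelPi fun _ : Fin k => EuclideanSpace ℝ (Fin 1)))
      (M × Torus k) := chart_mem_atlas _ _
  have hf := contMDiffOn_of_mem_maximalAtlas (I := corrModel k EM) (n := ∞)
    (IsManifold.subset_maximalAtlas
      (show (localTriv P e).trans χ ∈ atlas _ (Correspondence P Q) from ⟨e, he, χ, hat, rfl⟩))
  have hs := contMDiffOn_symm_of_mem_maximalAtlas (I := corrModel k EM) (n := ∞)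
    (IsManifold.subset_maximalAtlas hat)
  have hcs : c ∈ ((localTriv P e).trans χ).source := 
    ⟨hc, mem_chart_source (ModelProd EM (ModelPi fun _ : Fin k => EuclideanSpace ℝ (Fin 1)))
      (localTriv P e c)⟩
  have h1 : ContMDiffOn (corrModel k EM) (corrModel k EM) ∞
      (χ.symm ∘ ((localTriv P e).trans χ)) ((localTriv P e).trans χ).source :=
    hs.comp hf fun y hy => ((localTriv P e).trans χ).map_source hy |>.1
  have h2 := h1.contMDiffAt (((localTriv P e).trans χ).open_source.mem_nhds hcs)
  refine (h2.congr_of_eventuallyEq ?_).contMDiffWithinAt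
  filter_upwards [((localTriv P e).trans χ).open_source.mem_nhds hcs] with y hy
  exact (χ.left_inv hy.2).symm

theorem contMDiffOn_localTriv_symm [IsManifold 𝓘(ℝ, EM) ∞ M]
    {e : Trivialization (Torus k) Q.proj} (he : IsPrincipalTrivialization k EB EM' e) :
    ContMDiffOn (corrModel k EM) (corrModel k EM) ∞ (localTriv P e).symm
      (localTriv P e).target := by
  intro q hq
  set χ := chartAt (ModelProd EM (ModelPi fun _ : Fin k => EuclideanSpace ℝ (Fin 1))) q with hχ
  have hat : χ ∈ atlas (ModelProd EM (ModelPi fun _ : Fin k => EuclideanSpace ℝ (Fin 1)))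
      (M × Torus k) := chart_mem_atlas _ _
  have hf := contMDiffOn_symm_of_mem_maximalAtlas (I := corrModel k EM) (n := ∞)
    (IsManifold.subset_maximalAtlas
      (show (localTriv P e).trans χ ∈ atlas _ (Correspondence P Q) from ⟨e, he, χ, hat, rfl⟩))
  have hs := contMDiffOn_of_mem_maximalAtlas (I := corrModel k EM) (n := ∞)
    (IsManifold.subset_maximalAtlas hat)
  have hop : (localTriv P e).target ∩ χ.source ∈ 𝓝 q :=
    ((localTriv P e).open_target.inter χ.open_source).mem_nhds ⟨hq, mem_chart_source _ _⟩
  have h1 : ContMDiffOn (corrModel k EM) (corrModel k EM) ∞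
      (((localTriv P e).trans χ).symm ∘ χ) ((localTriv P e).target ∩ χ.source) := by
    refine hf.comp (hs.mono inter_subset_right) fun y hy => ?_
    rw [OpenPartialHomeomorph.trans_target]
    refine ⟨χ.map_source hy.2, ?_⟩
    change χ.symm (χ y) ∈ (localTriv P e).target
    rw [χ.left_inv hy.2]
    exact hy.1
  refine ((h1.contMDiffAt hop).congr_of_eventuallyEq ?_).contMDiffWithinAt
  filter_upwards [hop] with y hy
  change (localTriv P e).symm y = (localTriv P e).symm (χ.symm (χ y))
  rw [χ.left_inv hy.2]

theorem contMDiff_fst [IsManifold 𝓘(ℝ, EM) ∞ M] :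
    ContMDiff (corrModel k EM) 𝓘(ℝ, EM) ∞ (fst : Correspondence P Q → M) := by
  intro c
  obtain ⟨e, hb, he⟩ := Q.exists_trivialization (Q.proj c.snd)
  exact contMDiffAt_fst.comp c
    ((contMDiffOn_localTriv he).contMDiffAt ((localTriv P e).open_source.mem_nhds hb))

theorem contMDiff_snd [IsManifold 𝓘(ℝ, EM) ∞ M] :
    ContMDiff (corrModel k EM) 𝓘(ℝ, EM') ∞ (snd : Correspondence P Q → M') := by
  intro c
  obtain ⟨e, hb, he⟩ := Q.exists_trivialization (Q.proj c.snd)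
  have hU := (localTriv P e).open_source.mem_nhds (show c ∈ (localTriv P e).source from hb)
  have h1 : ContMDiffOn (corrModel k EM) (torusModel k) ∞
      (fun c : Correspondence P Q => (e c.snd).2) (localTriv P e).source :=
    fun x hx => (contMDiffAt_snd (I := 𝓘(ℝ, EM))
      (p := localTriv P e x)).comp_contMDiffWithinAt x (contMDiffOn_localTriv he x hx)
  have h2 : ContMDiffOn (corrModel k EM) 𝓘(ℝ, EM') ∞
      (fun c : Correspondence P Q =>
        e.toOpenPartialHomeomorph.symm (P.proj c.fst, (e c.snd).2)) (localTriv P e).source := by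
    refine he.2.1.comp (((P.contMDiff_proj.comp contMDiff_fst).contMDiffOn).prodMk h1) ?_
    intro x hx
    refine e.mem_target.2 ?_
    change P.proj x.fst ∈ e.baseSet
    rw [x.comm]
    exact hx
  refine (h2.contMDiffAt hU).congr_of_eventuallyEq ?_
  filter_upwards [hU] with x hx
  rw [x.comm]
  exact (e.symm_apply_mk_proj (e.mem_source.2 hx)).symm

/-- A map into the correspondence space is smooth if its two components are. -/
theorem contMDiff_of_components [IsManifold 𝓘(ℝ, EM) ∞ M]
    {EN : Type*} [NormedAddCommGroup EN] [NormedSpace ℝ EN] {HN : Type*} [TopologicalSpace HN]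
    {J : ModelWithCorners ℝ EN HN} {N : Type*} [TopologicalSpace N] [ChartedSpace HN N]
    {f : N → Correspondence P Q} (h1 : ContMDiff J 𝓘(ℝ, EM) ∞ fun x => (f x).fst)
    (h2 : ContMDiff J 𝓘(ℝ, EM') ∞ fun x => (f x).snd) : ContMDiff J (corrModel k EM) ∞ f := by
  intro x
  have hc : Continuous f :=
    isInducing.continuous_iff.2 (h1.continuous.prodMk h2.continuous)
  obtain ⟨e, hb, he⟩ := Q.exists_trivialization (Q.proj (f x).snd)
  have hb' : f x ∈ (localTriv P e).source := hb
  have hU : f ⁻¹' (localTriv P e).source ∈ 𝓝 x :=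
    ((localTriv P e).open_source.preimage hc).mem_nhds hb'
  have h3 : ContMDiffAt J (torusModel k) ∞ (fun y => (e (f y).snd).2) x :=
    contMDiffAt_snd.comp x ((he.1.contMDiffAt
      (e.open_source.mem_nhds (e.mem_source.2 hb))).comp x (h2 x))
  have h4 : ContMDiffAt J (corrModel k EM) ∞ (fun y => localTriv P e (f y)) x :=
    (h1 x).prodMk h3
  have h5 := ((contMDiffOn_localTriv_symm (P := P) he).contMDiffAt
    ((localTriv P e).open_target.mem_nhds ((localTriv P e).map_source hb'))).comp x h4
  refine h5.congr_of_eventuallyEq ?_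
  filter_upwards [hU] with y hy
  exact ((localTriv P e).left_inv hy).symm

end Correspondence

end Correspondence

/-! ### T-duality -/

section Duality

variable {k : ℕ}
  {EB : Type*} [NormedAddCommGroup EB] [NormedSpace ℝ EB]
  {EM : Type*} [NormedAddCommGroup EM] [NormedSpace ℝ EM]
  {EM' : Type*} [NormedAddCommGroup EM'] [NormedSpace ℝ EM']
  {B : Type*} [TopologicalSpace B] [ChartedSpace EB B]
  {M : Type*} [TopologicalSpace M] [ChartedSpace EM M] [MulAction (Torus k) M]
  {M' : Type*} [TopologicalSpace M'] [ChartedSpace EM' M'] [MulAction (Torus k) M']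
  {P : PrincipalTorusBundle k EB EM B M} {Q : PrincipalTorusBundle k EB EM' B M'}

/-- The 3-forms allowed as twists: smooth, closed and invariant. -/
structure IsFlux (k : ℕ) {EM : Type*} [NormedAddCommGroup EM] [NormedSpace ℝ EM]
    {M : Type*} [TopologicalSpace M] [ChartedSpace EM M] [MulAction (Torus k) M]
    (h : DForm 𝓘(ℝ, EM) M 3) : Prop where
  smooth : IsSmoothForm 𝓘(ℝ, EM) h
  closed : mextDeriv 𝓘(ℝ, EM) h = 0
  invariant : IsInvariantForm 𝓘(ℝ, EM) (Torus k) h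

/-- The differential of the projection `p : M ×_B M' → M` at `c`. -/
def dFst (c : Correspondence P Q) :
    TangentSpace (corrModel k EM) c →L[ℝ] TangentSpace 𝓘(ℝ, EM) c.fst :=
  mfderiv (corrModel k EM) 𝓘(ℝ, EM) (Correspondence.fst : Correspondence P Q → M) c

/-- The differential of the projection `q : M ×_B M' → M'` at `c`. -/
def dSnd (c : Correspondence P Q) :
    TangentSpace (corrModel k EM) c →L[ℝ] TangentSpace 𝓘(ℝ, EM') c.snd :=
  mfderiv (corrModel k EM) 𝓘(ℝ, EM') (Correspondence.snd : Correspondence P Q → M') c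

/-- The 2-form `F` on the correspondence space exhibits `(M, h)` and `(M', h')` as T-dual:
it is smooth, `T^{2k}`-invariant, satisfies `p^* h - q^* h' = dF`, and pairs the tangent space
`ker dq` of the fibres of `M ×_B M' → M'` nondegenerately with the tangent space `ker dp` of the
fibres of `M ×_B M' → M`. -/
structure IsTDuality (h : DForm 𝓘(ℝ, EM) M 3) (h' : DForm 𝓘(ℝ, EM') M' 3)
    (F : DForm (corrModel k EM) (Correspondence P Q) 2) : Prop where
  smooth : IsSmoothForm (corrModel k EM) F
  invariant : IsInvariantForm (corrModel k EM) (Torus k × Torus k) F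
  sub_eq_deriv :
    pullbackForm (corrModel k EM) 𝓘(ℝ, EM) (Correspondence.fst : Correspondence P Q → M) h
      - pullbackForm (corrModel k EM) 𝓘(ℝ, EM') (Correspondence.snd : Correspondence P Q → M') h'
      = mextDeriv (corrModel k EM) F
  nondegenerate_left : ∀ (c : Correspondence P Q) (Y : TangentSpace (corrModel k EM) c),
    dSnd c Y = 0 → (∀ Z, dFst c Z = 0 → F c ![Y, Z] = 0) → Y = 0
  nondegenerate_right : ∀ (c : Correspondence P Q) (Z : TangentSpace (corrModel k EM) c),
    dFst c Z = 0 → (∀ Y, dSnd c Y = 0 → F c ![Y, Z] = 0) → Z = 0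

/-- `X̂` is a lift of the vector part of `v = X + ξ` for which the covector part of the `B`-field
transform `X̂ + p^* ξ - F(X̂)` annihilates the fibres of `M ×_B M' → M'`. -/
def IsBasicLift (F : DForm (corrModel k EM) (Correspondence P Q) 2) (c : Correspondence P Q)
    (v : GenTangent 𝓘(ℝ, EM) c.fst) (X : TangentSpace (corrModel k EM) c) : Prop :=
  dFst c X = v.1 ∧ ∀ Y, dSnd c Y = 0 → v.2 (fun _ => dFst c Y) - F c ![X, Y] = 0

/-- `w = X' + ξ'` is the image of `v = X + ξ` under the T-duality map, computed at the point `c`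
of the correspondence space: for a basic lift `X̂` of `v`, one has `X' = dq X̂` and
`q^* ξ' = p^* ξ - F(X̂)`. -/
def IsTDualAt (F : DForm (corrModel k EM) (Correspondence P Q) 2) (c : Correspondence P Q)
    (v : GenTangent 𝓘(ℝ, EM) c.fst) (w : GenTangent 𝓘(ℝ, EM') c.snd) : Prop :=
  ∃ X : TangentSpace (corrModel k EM) c, IsBasicLift F c v X ∧ w.1 = dSnd c X ∧
    ∀ Y, w.2 (fun _ => dSnd c Y) = v.2 (fun _ => dFst c Y) - F c ![X, Y]

end Duality

end TDuality

end

open TDuality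

/-! The T-duality map pulls a section back to the correspondence space C, transforms it by the
B-field F and pushes the result down to the other side. Writing p and q for the two projections,
everything is phrased through one pointwise relation: v and w are dual at c if some tangent vector
of C projects to both vector parts and q^*(covector of w) = p^*(covector of v) - F(lift, ·).

Pointwise this is linear algebra. A vector at p(c) has lifts differing by ker p_*, and nondegeneracy
of F between ker q_* and ker p_* selects exactly one for which the corrected covector kills ker q_*,
so that it descends (`isInvertible_dualitySystem`, `IsLinearLift.unique`). Skew-symmetry of F makes
the pairing invariant. Exchanging p with q and F with -F gives the inverse relation, so each
construction is needed in one direction only.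

For invariant sections, the fibres of q are orbits of the first torus factor. Invariance of F and of
the section transports duality along these orbits, so the dual does not depend on the chosen point
of the fibre (`IsDualPair.exists_invariant_dual`). Smoothness of the lift follows because it solves
an invertible linear system with smooth coefficients (`IsDualPair.isSmoothFieldAt_lift`); the dual
section is then smooth because q has smooth local sections.

For the bracket, the lifts of two sections are vector fields on C related to the vector parts on
both sides, hence so is their Lie bracket. The pulled-back covectors differ by contractions of F and
the pulled-back fluxes by dF. The Cartan-type identity `mextDeriv_contraction_identity` says that
these corrections add up to the contraction of F with the bracket of the lifts
(`courantForm_sub_contract`). Thus that bracket witnesses duality of the two Courant brackets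
(`DualSections.courantBracket`), and uniqueness of duals turns the relation into an equation. -/

set_option linter.unusedSectionVars false

/-! ### Calculus of forms and vector fields on a vector space -/

section VectorSpace

variable {E : Type*} [NormedAddCommGroup E] [NormedSpace ℝ E]
  {E' : Type*} [NormedAddCommGroup E'] [NormedSpace ℝ E']
  {E'' : Type*} [NormedAddCommGroup E''] [NormedSpace ℝ E'']

open ContinuousAlternatingMap

theorem contDiff_curryLeft (n : ℕ) :
    ContDiff ℝ ∞ (fun a : E [⋀^Fin (n + 1)]→L[ℝ] ℝ => curryLeft a) :=
  LinearIsometry.contDiff (𝕜 := ℝ) (E := E [⋀^Fin (n + 1)]→L[ℝ] ℝ) (F := E →L[ℝ] E [⋀^Fin n]→L[ℝ] ℝ)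
    curryLeftLI

theorem contDiff_alternatizeUncurryFin (n : ℕ) :
    ContDiff ℝ ∞ (fun a : E →L[ℝ] E [⋀^Fin n]→L[ℝ] ℝ => alternatizeUncurryFin a) :=
  ContinuousLinearMap.contDiff (𝕜 := ℝ) (E := E →L[ℝ] E [⋀^Fin n]→L[ℝ] ℝ)
    (F := E [⋀^Fin (n + 1)]→L[ℝ] ℝ) (alternatizeUncurryFinCLM ℝ E ℝ)

/-- Pullback of alternating forms is smooth in the form and in the linear map. -/
theorem contDiff_compContinuousLinearMap [FiniteDimensional ℝ E] (n : ℕ) :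
    ContDiff ℝ ∞ (fun q : (E' [⋀^Fin n]→L[ℝ] ℝ) × (E →L[ℝ] E') =>
      q.1.compContinuousLinearMap q.2) := by
  induction n with
  | zero =>
    have h : (fun q : (E' [⋀^Fin 0]→L[ℝ] ℝ) × (E →L[ℝ] E') => q.1.compContinuousLinearMap q.2) =
        fun q => constOfIsEmptyLIE ℝ E ℝ (Fin 0) ((constOfIsEmptyLIE ℝ E' ℝ (Fin 0)).symm q.1) := by
      funext q
      ext v
      change q.1 _ = q.1 0
      exact congrArg q.1 (Subsingleton.elim _ _)
    rw [h]
    exact (constOfIsEmptyLIE ℝ E ℝ (Fin 0)).contDiff.comp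
      ((constOfIsEmptyLIE ℝ E' ℝ (Fin 0)).symm.contDiff.comp contDiff_fst)
  | succ n ih =>
    -- Alternatizing the curried form multiplies it by its degree n + 1. Dividing by that factor
    -- recovers the pullback from its contractions, which are pullbacks of degree n.
    have h : (fun q : (E' [⋀^Fin (n + 1)]→L[ℝ] ℝ) × (E →L[ℝ] E') =>
        q.1.compContinuousLinearMap q.2) = fun q => ((n : ℝ) + 1)⁻¹ •
          alternatizeUncurryFin (curryLeft (q.1.compContinuousLinearMap q.2)) := by
      funext q
      have h0 : (n : ℝ) + 1 ≠ 0 := by positivity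
      rw [alternatizeUncurryFin_curryLeft, ← Nat.cast_smul_eq_nsmul ℝ,
        smul_smul]
      push_cast
      rw [inv_mul_cancel₀ h0, one_smul]
    rw [h]
    refine ContDiff.const_smul _ ((contDiff_alternatizeUncurryFin n).comp
      (f := fun q : (E' [⋀^Fin (n + 1)]→L[ℝ] ℝ) × (E →L[ℝ] E') =>
        curryLeft (q.1.compContinuousLinearMap q.2)) ?_)
    -- As `E` is finite-dimensional, smoothness of an operator-valued map can be tested on one
    -- vector at a time.
    refine contDiff_clm_apply_iff.2 fun x => ?_
    have h1 : (fun q : (E' [⋀^Fin (n + 1)]→L[ℝ] ℝ) × (E →L[ℝ] E') =>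
        curryLeft (q.1.compContinuousLinearMap q.2) x) =
        fun q => (curryLeft q.1 (q.2 x)).compContinuousLinearMap q.2 := by
      funext q
      rw [curryLeft_compContinuousLinearMap]
    rw [h1]
    refine ih.comp (ContDiff.prodMk ?_ contDiff_snd)
    exact ((contDiff_curryLeft n).comp contDiff_fst).clm_apply
      (contDiff_snd.clm_apply contDiff_const)

theorem ContDiffAt.compContinuousLinearMap_form [FiniteDimensional ℝ E] {n : ℕ}
    {a : E'' → E' [⋀^Fin n]→L[ℝ] ℝ} {L : E'' → E →L[ℝ] E'} {z : E''} (ha : ContDiffAt ℝ ∞ a z)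
    (hL : ContDiffAt ℝ ∞ L z) :
    ContDiffAt ℝ ∞ (fun y => (a y).compContinuousLinearMap (L y)) z :=
  (contDiff_compContinuousLinearMap n).contDiffAt.comp z (ha.prodMk hL)

theorem ContDiffAt.curryLeft_apply {n : ℕ} {a : E'' → E [⋀^Fin (n + 1)]→L[ℝ] ℝ} {X : E'' → E}
    {z : E''} (ha : ContDiffAt ℝ ∞ a z) (hX : ContDiffAt ℝ ∞ X z) :
    ContDiffAt ℝ ∞ (fun y => curryLeft (a y) (X y)) z :=
  ((contDiff_curryLeft n).contDiffAt.comp z ha).clm_apply hX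

theorem ContDiffAt.extDeriv_form {n : ℕ} {a : E → E [⋀^Fin n]→L[ℝ] ℝ} {z : E}
    (ha : ContDiffAt ℝ ∞ a z) : ContDiffAt ℝ ∞ (extDeriv a) z :=
  (contDiff_alternatizeUncurryFin n).contDiffAt.comp (f := fderiv ℝ a) z
    (ha.fderiv_right (m := ∞) le_rfl)

/-- The identity `L_X i_Y F - i_Y d i_X F = i_[X,Y] F + i_Y i_X dF` for a 2-form on a vector
space. -/
theorem extDeriv_contraction_identity {F : E → E [⋀^Fin 2]→L[ℝ] ℝ} {X Y : E → E} {z : E}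
    (hF : DifferentiableAt ℝ F z) (hX : DifferentiableAt ℝ X z) (hY : DifferentiableAt ℝ Y z)
    (Z : E) :
    extDeriv (fun y => curryLeft (curryLeft (F y) (Y y)) (X y)) z ![Z]
      + extDeriv (fun y => curryLeft (F y) (Y y)) z ![X z, Z]
      - extDeriv (fun y => curryLeft (F y) (X y)) z ![Y z, Z]
      - extDeriv F z ![X z, Y z, Z] = F z ![VectorField.lieBracket ℝ X Y z, Z] := by
  have hc {n : ℕ} {a : E → E [⋀^Fin (n + 1)]→L[ℝ] ℝ} {X : E → E} (ha : DifferentiableAt ℝ a z)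
      (hX : DifferentiableAt ℝ X z) : DifferentiableAt ℝ (fun y => curryLeft (a y) (X y)) z :=
    (((contDiff_curryLeft n).differentiable (by simp) _).comp z ha).clm_apply hX
  -- Leibniz rule for evaluating the form on two variable fields. All terms below are instances of
  -- it, some with fields frozen at `z`.
  have hev (V W : E → E) (hV : DifferentiableAt ℝ V z) (hW : DifferentiableAt ℝ W z) (u : E) :
      fderiv ℝ (fun y => F y ![V y, W y]) z u = fderiv ℝ F z u ![V z, W z]
        + F z ![fderiv ℝ V z u, W z] + F z ![V z, fderiv ℝ W z u] := by
    have h1 := fderiv_continuousAlternatingMap_apply_apply (g := ![V, W]) hF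
      (by simp [Fin.forall_fin_two, hV, hW]) u
    have h2 (y : E) : (![V, W] · y) = ![V y, W y] := by ext i; fin_cases i <;> rfl
    simp only [h2] at h1
    rw [h1]
    have h3 (a b c : E) : Function.update ![a, b] 0 c = ![c, b] := by ext i; fin_cases i <;> rfl
    have h4 (a b c : E) : Function.update ![a, b] 1 c = ![a, c] := by ext i; fin_cases i <;> rfl
    simp [Fin.sum_univ_succ, add_assoc, h3, h4]
  have e0 : extDeriv (fun y => curryLeft (curryLeft (F y) (Y y)) (X y)) z ![Z] =
      fderiv ℝ (fun y => F y ![Y y, X y]) z Z := by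
    rw [extDeriv_apply (hc (hc hF hY) hX)]
    simp
  have e1 (V W : E → E) (hV : DifferentiableAt ℝ V z) :
      extDeriv (fun y => curryLeft (F y) (V y)) z ![W z, Z] =
      fderiv ℝ (fun y => F y ![V y, Z]) z (W z) - fderiv ℝ (fun y => F y ![V y, W z]) z Z := by
    rw [extDeriv_apply (hc hF hV)]
    have h : Fin.removeNth 0 ![W z, Z] = ![Z] := by ext i; fin_cases i; rfl
    have h' : Fin.removeNth 1 ![W z, Z] = ![W z] := by ext i; fin_cases i; rfl
    rw [Fin.sum_univ_two, h, h']
    simp [sub_eq_add_neg]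
  have e2 : extDeriv F z ![X z, Y z, Z] = fderiv ℝ (fun y => F y ![Y z, Z]) z (X z)
      - fderiv ℝ (fun y => F y ![X z, Z]) z (Y z) + fderiv ℝ (fun y => F y ![X z, Y z]) z Z := by
    rw [extDeriv_apply hF]
    have h : Fin.removeNth 0 ![X z, Y z, Z] = ![Y z, Z] := by ext i; fin_cases i <;> rfl
    have h' : Fin.removeNth 1 ![X z, Y z, Z] = ![X z, Z] := by ext i; fin_cases i <;> rfl
    have h'' : Fin.removeNth 2 ![X z, Y z, Z] = ![X z, Y z] := by ext i; fin_cases i <;> rfl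
    rw [Fin.sum_univ_three]
    simp [h, h', h'', sub_eq_add_neg]
  have hcst (u : E) : DifferentiableAt ℝ (fun _ : E => u) z := differentiableAt_const _
  have hswap (G : E [⋀^Fin 2]→L[ℝ] ℝ) (u v : E) : G ![u, v] = - G ![v, u] := by
    have h := G.map_swap ![v, u] (i := 0) (j := 1) (by simp)
    refine Eq.trans ?_ h
    exact congrArg G (by ext i; fin_cases i <;> rfl)
  have hsub (u v w : E) : F z ![u - v, w] = F z ![u, w] - F z ![v, w] := by
    have h (u : E) : F z ![u, w] = curryLeft (F z) u ![w] := rfl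
    rw [h, h, h, map_sub, ContinuousAlternatingMap.sub_apply]
  -- After expansion the derivatives of F cancel, as do the terms containing the derivatives of X
  -- and Y along Z. What survives is F applied to DY(X) - DX(Y).
  rw [e0, e1 Y X hY, e1 X Y hX, e2, hev Y X hY hX, hev Y (fun _ => Z) hY (hcst _),
    hev Y (fun _ => X z) hY (hcst _), hev X (fun _ => Z) hX (hcst _),
    hev X (fun _ => Y z) hX (hcst _), hev (fun _ => Y z) (fun _ => Z) (hcst _) (hcst _),
    hev (fun _ => X z) (fun _ => Z) (hcst _) (hcst _),
    hev (fun _ => X z) (fun _ => Y z) (hcst _) (hcst _), VectorField.lieBracket, hsub]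
  have h0 (u : E) : F z ![0, u] = 0 := (F z).map_coord_zero 0 rfl
  have h0' (u : E) : F z ![u, 0] = 0 := (F z).map_coord_zero 1 rfl
  simp only [fderiv_fun_const, Pi.zero_apply, zero_apply, h0, h0']
  rw [hswap (F z) (Y z) (fderiv ℝ X z Z), hswap (fderiv ℝ F z Z) (X z) (Y z)]
  ring

/-- Lie brackets of related vector fields are related. -/
theorem fderiv_lieBracket_of_related {f : E → E'} {X Y : E → E} {X' Y' : E' → E'} {z : E}
    (hf : ContDiffAt ℝ ∞ f z) (hX : DifferentiableAt ℝ X z) (hY : DifferentiableAt ℝ Y z)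
    (hX' : DifferentiableAt ℝ X' (f z)) (hY' : DifferentiableAt ℝ Y' (f z))
    (hXX' : ∀ᶠ y in 𝓝 z, fderiv ℝ f y (X y) = X' (f y))
    (hYY' : ∀ᶠ y in 𝓝 z, fderiv ℝ f y (Y y) = Y' (f y)) :
    fderiv ℝ f z (VectorField.lieBracket ℝ X Y z) = VectorField.lieBracket ℝ X' Y' (f z) := by
  have hf' : DifferentiableAt ℝ f z := hf.differentiableAt (by simp)
  -- Symmetry of the second derivative of f expresses Df[X, Y] through the derivatives of Df(Y) and
  -- Df(X), which relatedness replaces by Y' ∘ f and X' ∘ f near z.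
  rw [VectorField.fderiv_apply_lieBracket hf (by simpa using ENat.LEInfty.out) hY hX,
    Filter.EventuallyEq.fderiv_eq hYY', Filter.EventuallyEq.fderiv_eq hXX',
    fderiv_fun_comp _ hY' hf', fderiv_fun_comp _ hX' hf']
  simp [VectorField.lieBracket, hXX'.self_of_nhds, hYY'.self_of_nhds]

end VectorSpace

/-! ### Forms on manifolds and charts -/

section Manifold

variable {E : Type*} [NormedAddCommGroup E] [NormedSpace ℝ E] {H : Type*} [TopologicalSpace H]
  {I : ModelWithCorners ℝ E H} {M : Type*} [TopologicalSpace M] [ChartedSpace H M]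
  {E' : Type*} [NormedAddCommGroup E'] [NormedSpace ℝ E'] {H' : Type*} [TopologicalSpace H']
  {I' : ModelWithCorners ℝ E' H'} {M' : Type*} [TopologicalSpace M'] [ChartedSpace H' M']
  {E₀ : Type*} [NormedAddCommGroup E₀] [NormedSpace ℝ E₀]

/-- The pullback of a form on `M` by a map from a vector space to `M`. -/
noncomputable def modelPullback {n : ℕ} (g : E₀ → M) (α : DForm I M n) :
    E₀ → E₀ [⋀^Fin n]→L[ℝ] ℝ := fun y =>
  (α (g y)).compContinuousLinearMap (mfderiv 𝓘(ℝ, E₀) I g y)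

theorem modelPullback_apply {n : ℕ} (g : E₀ → M) (α : DForm I M n) (y : E₀) (v : Fin n → E₀) :
    modelPullback g α y v = α (g y) (fun i => mfderiv 𝓘(ℝ, E₀) I g y (v i)) := rfl

/-- All tangent spaces are definitionally the model space, so vectors at two provably equal points
can be compared there. This avoids rewriting inside dependent types when a base point changes. -/
theorem DForm.apply_congr {n : ℕ} (α : DForm I M n) {x x' : M} (h : x = x') {v v' : Fin n → E}
    (hv : v = v') : (α x : E [⋀^Fin n]→L[ℝ] ℝ) v = (α x' : E [⋀^Fin n]→L[ℝ] ℝ) v' := by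
  subst h hv; rfl

/-- Without boundary the derivative within the range of the model is the ordinary one. Chart
expressions become a special case of pullback from a vector space. -/
theorem formInChart_eq_modelPullback [I.Boundaryless] {n : ℕ} (α : DForm I M n) (x₀ : M) :
    formInChart I α x₀ = modelPullback (extChartAt I x₀).symm α := by
  funext y
  simp only [formInChart, modelPullback, I.range_eq_univ, mfderivWithin_univ]

/-- Smoothness of a form at a point. -/
def IsSmoothFormAt {n : ℕ} (α : DForm I M n) (x : M) : Prop :=
  ContDiffAt ℝ ∞ (formInChart I α x) (extChartAt I x x)

section Boundaryless

variable [I.Boundaryless] [I'.Boundaryless] [IsManifold I ∞ M] [IsManifold I' ∞ M']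

theorem contMDiffAt_extChartAt_symm {x₀ : M} {z : E} (hz : z ∈ (extChartAt I x₀).target) :
    ContMDiffAt 𝓘(ℝ, E) I ∞ (extChartAt I x₀).symm z :=
  (contMDiffOn_extChartAt_symm x₀).contMDiffAt ((isOpen_extChartAt_target x₀).mem_nhds hz)

theorem mfderiv_extChartAt_symm_comp {x₀ x : M} (hx : x ∈ (extChartAt I x₀).source)
    (v : TangentSpace I x) :
    mfderiv 𝓘(ℝ, E) I (extChartAt I x₀).symm (extChartAt I x₀ x)
      (mfderiv I 𝓘(ℝ, E) (extChartAt I x₀) x v) = v := by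
  have : IsManifold I 1 M := .of_le (n := ∞) (by simp)
  have h := mfderivWithin_extChartAt_symm_comp_mfderiv_extChartAt' (I := I) hx
  rw [I.range_eq_univ, mfderivWithin_univ] at h
  exact congrArg (fun L => L v) h

theorem mfderiv_extChartAt_comp_symm {x₀ : M} {z : E} (hz : z ∈ (extChartAt I x₀).target) (u : E) :
    mfderiv I 𝓘(ℝ, E) (extChartAt I x₀) ((extChartAt I x₀).symm z)
      (mfderiv 𝓘(ℝ, E) I (extChartAt I x₀).symm z u) = u := by
  have : IsManifold I 1 M := .of_le (n := ∞) (by simp)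
  have h := mfderiv_extChartAt_comp_mfderivWithin_extChartAt_symm (I := I) hz
  rw [I.range_eq_univ, mfderivWithin_univ] at h
  exact congrArg (fun L => L u) h

/-- The expression of a smooth map from a vector space in a chart of the target. -/
theorem contDiffAt_extChartAt_comp {g : E₀ → M} {y : E₀} {x₀ : M}
    (hg : ContMDiffAt 𝓘(ℝ, E₀) I ∞ g y) (hx : g y ∈ (extChartAt I x₀).source) :
    ContDiffAt ℝ ∞ (fun y => extChartAt I x₀ (g y)) y := by
  rw [← contMDiffAt_iff_contDiffAt]
  exact (contMDiffAt_extChartAt' (by rwa [extChartAt_source] at hx)).comp y hg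

theorem ContMDiffAt.eventually_mdifferentiableAt {g : M → M'} {y : M}
    (hg : ContMDiffAt I I' ∞ g y) : ∀ᶠ y' in 𝓝 y, MDifferentiableAt I I' g y' := by
  have : IsManifold I 1 M := .of_le (n := ∞) (by simp)
  have : IsManifold I' 1 M' := .of_le (n := ∞) (by simp)
  have h1 : ContMDiffAt I I' 1 g y := hg.of_le (by simp)
  filter_upwards [(contMDiffAt_iff_contMDiffAt_nhds (by simp)).1 h1] with y' hy'
  exact hy'.mdifferentiableAt one_ne_zero

/-- Near `y` the map g is the inverse chart composed with its chart expression, so the chain rule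
factors the pullback through the chart. This reduces smoothness and exterior derivatives of
pullbacks to vector spaces. -/
theorem modelPullback_eventuallyEq {n : ℕ} {g : E₀ → M} {y : E₀} {x₀ : M} (α : DForm I M n)
    (hg : ContMDiffAt 𝓘(ℝ, E₀) I ∞ g y) (hx : g y ∈ (extChartAt I x₀).source) :
    modelPullback g α =ᶠ[𝓝 y] fun y' =>
      (formInChart I α x₀ (extChartAt I x₀ (g y'))).compContinuousLinearMap
        (fderiv ℝ (fun y => extChartAt I x₀ (g y)) y') := by
  have hs := hg.continuousAt.preimage_mem_nhds ((isOpen_extChartAt_source x₀).mem_nhds hx)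
  filter_upwards [hs, hg.eventually_mdifferentiableAt] with y' hy' hd
  have hy'' : g y' ∈ (extChartAt I x₀).source := hy'
  ext v
  rw [formInChart_eq_modelPullback, ContinuousAlternatingMap.compContinuousLinearMap_apply,
    modelPullback_apply, modelPullback_apply]
  have hd1 : MDifferentiableAt I 𝓘(ℝ, E) (extChartAt I x₀) (g y') :=
    (contMDiffAt_extChartAt' (n := ∞) (by rwa [extChartAt_source] at hy'')).mdifferentiableAt
      (by simp)
  have h1 (u : E₀) : fderiv ℝ (fun y => extChartAt I x₀ (g y)) y' u =
      mfderiv I 𝓘(ℝ, E) (extChartAt I x₀) (g y') (mfderiv 𝓘(ℝ, E₀) I g y' u) := by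
    rw [← mfderiv_eq_fderiv]
    exact mfderiv_comp_apply y' hd1 hd u
  have h2 (u : E₀) : mfderiv 𝓘(ℝ, E) I (extChartAt I x₀).symm (extChartAt I x₀ (g y'))
      (fderiv ℝ (fun y => extChartAt I x₀ (g y)) y' u) = mfderiv 𝓘(ℝ, E₀) I g y' u := by
    rw [h1]
    exact mfderiv_extChartAt_symm_comp hy'' _
  exact DForm.apply_congr α ((extChartAt I x₀).left_inv hy'').symm (funext fun i => (h2 (v i)).symm)

theorem contDiffAt_modelPullback [FiniteDimensional ℝ E₀] {n : ℕ} {g : E₀ → M} {y : E₀}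
    {α : DForm I M n} (hα : IsSmoothFormAt α (g y)) (hg : ContMDiffAt 𝓘(ℝ, E₀) I ∞ g y) :
    ContDiffAt ℝ ∞ (modelPullback g α) y := by
  have hx := mem_extChartAt_source (I := I) (g y)
  have hh := contDiffAt_extChartAt_comp hg hx
  refine ContDiffAt.congr_of_eventuallyEq ?_ (modelPullback_eventuallyEq α hg hx)
  refine ContDiffAt.compContinuousLinearMap_form ?_ (hh.fderiv_right (m := ∞) le_rfl)
  exact ContDiffAt.comp (g := formInChart I α (g y)) y hα hh

theorem fderiv_extChartAt_comp {g : E₀ → M} {y : E₀} {x₀ : M}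
    (hg : MDifferentiableAt 𝓘(ℝ, E₀) I g y) (hx : g y ∈ (extChartAt I x₀).source) (u : E₀) :
    fderiv ℝ (fun y => extChartAt I x₀ (g y)) y u =
      mfderiv I 𝓘(ℝ, E) (extChartAt I x₀) (g y) (mfderiv 𝓘(ℝ, E₀) I g y u) := by
  have hd1 : MDifferentiableAt I 𝓘(ℝ, E) (extChartAt I x₀) (g y) :=
    (contMDiffAt_extChartAt' (n := ∞) (by rwa [extChartAt_source] at hx)).mdifferentiableAt
      (by simp)
  rw [← mfderiv_eq_fderiv]
  exact mfderiv_comp_apply y hd1 hg u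

theorem mextDeriv_apply {n : ℕ} (α : DForm I M n) (x : M) (v : Fin (n + 1) → TangentSpace I x) :
    mextDeriv I α x v = extDeriv (formInChart I α x) (extChartAt I x x)
      (fun i => mfderiv I 𝓘(ℝ, E) (extChartAt I x) x (v i)) := by
  rw [← extDerivWithin_univ, ← I.range_eq_univ]
  rfl

/-- The exterior derivative commutes with pullback to a vector space. -/
theorem extDeriv_modelPullback {n : ℕ} {g : E₀ → M} {y : E₀} {α : DForm I M n}
    (hα : IsSmoothFormAt α (g y)) (hg : ContMDiffAt 𝓘(ℝ, E₀) I ∞ g y) :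
    extDeriv (modelPullback g α) y = modelPullback g (mextDeriv I α) y := by
  have hx := mem_extChartAt_source (I := I) (g y)
  have hh := contDiffAt_extChartAt_comp hg hx
  have hd : DifferentiableAt ℝ (formInChart I α (g y)) (extChartAt I (g y) (g y)) :=
    ContDiffAt.differentiableAt hα (by simp)
  rw [(modelPullback_eventuallyEq α hg hx).extDeriv_eq,
    extDeriv_pullback (f := fun y' => extChartAt I (g y) (g y')) hd hh
      (by simpa using ENat.LEInfty.out)]
  ext v
  rw [modelPullback_apply, mextDeriv_apply, ContinuousAlternatingMap.compContinuousLinearMap_apply]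
  congr 1
  funext i
  exact fderiv_extChartAt_comp (hg.mdifferentiableAt (by simp)) hx (v i)

/-- The right side looks only at the centre of each preferred chart. Any other point of a chart is
reached by a change of charts, namely smoothness of the pullback along the inverse chart. -/
theorem isSmoothForm_iff [FiniteDimensional ℝ E] {n : ℕ} {α : DForm I M n} :
    IsSmoothForm I α ↔ ∀ x, IsSmoothFormAt α x := by
  refine ⟨fun h x => (h x).contDiffAt (extChartAt_target_mem_nhds x), fun h x₀ z hz => ?_⟩
  rw [formInChart_eq_modelPullback]
  exact (contDiffAt_modelPullback (h _) (contMDiffAt_extChartAt_symm hz)).contDiffWithinAt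

/-- Near the base point of a chart, the chart expression of a pullback. -/
theorem formInChart_pullbackForm_eventuallyEq {n : ℕ} {f : M → M'} {x : M} (α : DForm I' M' n)
    (hf : ContMDiffAt I I' ∞ f x) :
    formInChart I (pullbackForm I I' f α) x =ᶠ[𝓝 (extChartAt I x x)]
      modelPullback (f ∘ (extChartAt I x).symm) α := by
  have hc : ContinuousAt (extChartAt I x).symm (extChartAt I x x) := continuousAt_extChartAt_symm x
  have hd := hf.eventually_mdifferentiableAt
  rw [← extChartAt_to_inv (I := I) x] at hd
  filter_upwards [hc.eventually hd, extChartAt_target_mem_nhds (I := I) x] with z hz hzt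
  rw [formInChart_eq_modelPullback]
  ext v
  rw [modelPullback_apply, modelPullback_apply]
  have h1 (u : E) : mfderiv 𝓘(ℝ, E) I' (f ∘ (extChartAt I x).symm) z u =
      mfderiv I I' f ((extChartAt I x).symm z) (mfderiv 𝓘(ℝ, E) I (extChartAt I x).symm z u) :=
    mfderiv_comp_apply z hz ((contMDiffAt_extChartAt_symm hzt).mdifferentiableAt (by simp)) u
  exact DForm.apply_congr α rfl (funext fun i => (h1 (v i)).symm)

theorem contMDiffAt_comp_extChartAt_symm {f : M → M'} {x : M} (hf : ContMDiffAt I I' ∞ f x) :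
    ContMDiffAt 𝓘(ℝ, E) I' ∞ (f ∘ (extChartAt I x).symm) (extChartAt I x x) := by
  refine ContMDiffAt.comp (extChartAt I x x) ?_
    (contMDiffAt_extChartAt_symm (mem_extChartAt_target x))
  rwa [extChartAt_to_inv x]

theorem IsSmoothFormAt.pullbackForm [FiniteDimensional ℝ E] {n : ℕ} {f : M → M'} {x : M}
    {α : DForm I' M' n} (hα : IsSmoothFormAt α (f x)) (hf : ContMDiffAt I I' ∞ f x) :
    IsSmoothFormAt (pullbackForm I I' f α) x := by
  refine ContDiffAt.congr_of_eventuallyEq ?_ (formInChart_pullbackForm_eventuallyEq α hf)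
  refine contDiffAt_modelPullback ?_ (contMDiffAt_comp_extChartAt_symm hf)
  rwa [Function.comp_apply, extChartAt_to_inv x]

/-- The exterior derivative commutes with pullback. -/
theorem mextDeriv_pullbackForm_apply {n : ℕ} {f : M → M'} {x : M} {α : DForm I' M' n}
    (hα : IsSmoothFormAt α (f x)) (hf : ContMDiffAt I I' ∞ f x) :
    mextDeriv I (pullbackForm I I' f α) x = pullbackForm I I' f (mextDeriv I' α) x := by
  ext v
  have hα' : IsSmoothFormAt α ((f ∘ (extChartAt I x).symm) (extChartAt I x x)) := by
    rwa [Function.comp_apply, extChartAt_to_inv x]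
  rw [mextDeriv_apply, (formInChart_pullbackForm_eventuallyEq α hf).extDeriv_eq,
    extDeriv_modelPullback hα' (contMDiffAt_comp_extChartAt_symm hf)]
  have hd : MDifferentiableAt I I' f ((extChartAt I x).symm (extChartAt I x x)) := by
    rw [extChartAt_to_inv x]
    exact hf.mdifferentiableAt (by simp)
  have h1 (u : TangentSpace I x) : (mfderiv 𝓘(ℝ, E) I' (f ∘ (extChartAt I x).symm)
      (extChartAt I x x) (mfderiv I 𝓘(ℝ, E) (extChartAt I x) x u) : E') = mfderiv I I' f x u := by
    rw [mfderiv_comp_apply _ hd ((contMDiffAt_extChartAt_symm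
      (mem_extChartAt_target x)).mdifferentiableAt (by simp)),
      mfderiv_extChartAt_symm_comp (mem_extChartAt_source x), extChartAt_to_inv x]
  exact DForm.apply_congr (mextDeriv I' α) (congrArg f (extChartAt_to_inv x))
    (funext fun i => h1 (v i))

theorem mextDeriv_sub {n : ℕ} {α β : DForm I M n} {x : M} (hα : IsSmoothFormAt α x)
    (hβ : IsSmoothFormAt β x) : mextDeriv I (α - β) x = mextDeriv I α x - mextDeriv I β x := by
  ext v
  rw [ContinuousAlternatingMap.sub_apply, mextDeriv_apply, mextDeriv_apply, mextDeriv_apply]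
  have hα' : DifferentiableAt ℝ (formInChart I α x) (extChartAt I x x) :=
    ContDiffAt.differentiableAt hα (by simp)
  have hβ' : DifferentiableAt ℝ (formInChart I β x) (extChartAt I x x) :=
    ContDiffAt.differentiableAt hβ (by simp)
  -- The difference is rewritten as a sum so that additivity and homogeneity of `extDeriv` apply.
  have h : formInChart I (α - β) x = formInChart I α x + (-1 : ℝ) • formInChart I β x := by
    funext z
    have h (a b : E [⋀^Fin n]→L[ℝ] ℝ) : a - b = a + (-1 : ℝ) • b := by
      ext u; simp [sub_eq_add_neg]
    exact h (formInChart I α x z) (formInChart I β x z)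
  have h' (a b : E [⋀^Fin (n + 1)]→L[ℝ] ℝ) (u : Fin (n + 1) → E) :
      (a + (-1 : ℝ) • b) u = a u - b u := by simp [sub_eq_add_neg]
  rw [h, extDeriv_add hα' (hβ'.const_smul _), extDeriv_smul]
  exact h' _ _ _

/-- `mextDeriv` uses a different chart at every point. Naturality under the inverse of one fixed
chart shows that its expression there is nevertheless the vector-space derivative throughout a
neighbourhood, which is why smoothness of α is needed at all points. -/
theorem IsSmoothFormAt.mextDeriv [FiniteDimensional ℝ E] {n : ℕ} {α : DForm I M n}
    (hα : ∀ x, IsSmoothFormAt α x) (x : M) : IsSmoothFormAt (mextDeriv I α) x := by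
  have h : formInChart I (TDuality.mextDeriv I α) x =ᶠ[𝓝 (extChartAt I x x)]
      extDeriv (formInChart I α x) := by
    filter_upwards [extChartAt_target_mem_nhds (I := I) x] with z hz
    rw [formInChart_eq_modelPullback, formInChart_eq_modelPullback,
      extDeriv_modelPullback (hα _) (contMDiffAt_extChartAt_symm hz)]
  exact ContDiffAt.congr_of_eventuallyEq (ContDiffAt.extDeriv_form (hα x)) h

end Boundaryless
end Manifold

/-! ### Vector fields on manifolds and charts -/

section Fields

variable {E : Type*} [NormedAddCommGroup E] [NormedSpace ℝ E] {H : Type*} [TopologicalSpace H]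
  {I : ModelWithCorners ℝ E H} {M : Type*} [TopologicalSpace M] [ChartedSpace H M]
  {E' : Type*} [NormedAddCommGroup E'] [NormedSpace ℝ E'] {H' : Type*} [TopologicalSpace H']
  {I' : ModelWithCorners ℝ E' H'} {M' : Type*} [TopologicalSpace M'] [ChartedSpace H' M']
  [I.Boundaryless] [I'.Boundaryless] [IsManifold I ∞ M] [IsManifold I' ∞ M']

/-- Smoothness of a vector field at a point. -/
def IsSmoothFieldAt (X : ∀ x : M, TangentSpace I x) (x : M) : Prop :=
  ContMDiffAt I I.tangent ∞ (fun x => (⟨x, X x⟩ : TangentBundle I M)) x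

/-- The expression of a vector field in the chart at `x₀`. -/
noncomputable def fieldInChart (X : ∀ x : M, TangentSpace I x) (x₀ : M) : E → E :=
  VectorField.mpullback 𝓘(ℝ, E) I (extChartAt I x₀).symm X

theorem isInvertible_mfderiv_extChartAt_symm {x₀ : M} {z : E} (hz : z ∈ (extChartAt I x₀).target) :
    (mfderiv 𝓘(ℝ, E) I (extChartAt I x₀).symm z).IsInvertible := by
  have : IsManifold I 1 M := .of_le (n := ∞) (by simp)
  rw [← mfderivWithin_univ, ← I.range_eq_univ]
  exact isInvertible_mfderivWithin_extChartAt_symm hz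

theorem mfderiv_extChartAt_symm_fieldInChart (X : ∀ x : M, TangentSpace I x) {x₀ : M} {z : E}
    (hz : z ∈ (extChartAt I x₀).target) :
    mfderiv 𝓘(ℝ, E) I (extChartAt I x₀).symm z (fieldInChart X x₀ z : E) =
      X ((extChartAt I x₀).symm z) :=
  (isInvertible_mfderiv_extChartAt_symm hz).self_apply_inverse _

theorem fieldInChart_extChartAt (X : ∀ x : M, TangentSpace I x) {x₀ x : M}
    (hx : x ∈ (extChartAt I x₀).source) :
    fieldInChart X x₀ (extChartAt I x₀ x) = mfderiv I 𝓘(ℝ, E) (extChartAt I x₀) x (X x) := by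
  have hz := (extChartAt I x₀).map_source hx
  refine (isInvertible_mfderiv_extChartAt_symm hz).injective ?_
  refine (mfderiv_extChartAt_symm_fieldInChart X hz).trans ?_
  refine Eq.trans ?_ (mfderiv_extChartAt_symm_comp hx (X x)).symm
  have h (y : M) (hy : y = x) : (X y : E) = X x := by rw [hy]
  exact h _ ((extChartAt I x₀).left_inv hx)

theorem IsSmoothFieldAt.contDiffAt_fieldInChart [CompleteSpace E] {X : ∀ x : M, TangentSpace I x}
    {x₀ : M} {z : E} (hz : z ∈ (extChartAt I x₀).target)
    (hX : IsSmoothFieldAt X ((extChartAt I x₀).symm z)) : ContDiffAt ℝ ∞ (fieldInChart X x₀) z := by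
  have h := ContMDiffAt.mpullback_vectorField_preimage (n := ∞) hX (contMDiffAt_extChartAt_symm hz)
    (isInvertible_mfderiv_extChartAt_symm hz) le_rfl
  exact contMDiffAt_vectorSpace_iff_contDiffAt.1 h

theorem IsSmoothFieldAt.contDiffAt_fieldInChart_self [CompleteSpace E]
    {X : ∀ x : M, TangentSpace I x} {x : M} (hX : IsSmoothFieldAt X x) :
    ContDiffAt ℝ ∞ (fieldInChart X x) (extChartAt I x x) := by
  refine IsSmoothFieldAt.contDiffAt_fieldInChart (mem_extChartAt_target x) ?_
  rwa [extChartAt_to_inv]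

/-- A vector field is smooth if it agrees with a smooth vector field in a chart. -/
theorem isSmoothFieldAt_of_chart [CompleteSpace E] {X : ∀ x : M, TangentSpace I x} {x : M}
    {V : E → E} (hV : ContDiffAt ℝ ∞ V (extChartAt I x x))
    (h : ∀ᶠ z in 𝓝 (extChartAt I x x), mfderiv 𝓘(ℝ, E) I (extChartAt I x).symm z (V z) =
      X ((extChartAt I x).symm z)) : IsSmoothFieldAt X x := by
  have : IsManifold I 1 M := .of_le (n := ∞) (by simp)
  have hV' := contMDiffAt_vectorSpace_iff_contDiffAt.2 hV
  have h1 := ContMDiffAt.mpullback_vectorField_preimage (n := ∞) hV'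
    (contMDiffAt_extChartAt (I := I) (x := x))
    (isInvertible_mfderiv_extChartAt (mem_extChartAt_source x)) le_rfl
  refine ContMDiffAt.congr_of_eventuallyEq h1 ?_
  filter_upwards [(continuousAt_extChartAt (I := I) x).eventually h,
    (isOpen_extChartAt_source (I := I) x).mem_nhds (mem_extChartAt_source x)] with y hy hys
  have h2 : X y = VectorField.mpullback I 𝓘(ℝ, E) (extChartAt I x) V y := by
    refine (isInvertible_mfderiv_extChartAt hys).injective ?_
    refine Eq.trans ?_ ((isInvertible_mfderiv_extChartAt hys).self_apply_inverse _).symm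
    have h3 := mfderiv_extChartAt_comp_symm ((extChartAt I x).map_source hys)
      (V (extChartAt I x y))
    rw [hy, (extChartAt I x).left_inv hys] at h3
    exact h3
  rw [h2]

/-- The manifold bracket is by definition the chart bracket carried back by the inverse of the
chart's differential; this undoes that last step. -/
theorem mfderiv_extChartAt_mlieBracket (X Y : ∀ x : M, TangentSpace I x) (x : M) :
    mfderiv I 𝓘(ℝ, E) (extChartAt I x) x (VectorField.mlieBracket I X Y x) =
      VectorField.lieBracket ℝ (fieldInChart X x) (fieldInChart Y x) (extChartAt I x x) := by
  have : IsManifold I 1 M := .of_le (n := ∞) (by simp)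
  rw [← VectorField.mlieBracketWithin_univ, VectorField.mlieBracketWithin_apply]
  refine ((isInvertible_mfderiv_extChartAt (mem_extChartAt_source x)).self_apply_inverse _).trans ?_
  have aux {A B A' B' : E → E} (hA : A = A') (hB : B = B') {s : Set E} (hs : s = univ) (y : E) :
      VectorField.lieBracketWithin ℝ A B s y = VectorField.lieBracket ℝ A' B' y := by
    subst hA hB hs
    rw [VectorField.lieBracketWithin_univ]
  have hf (X : ∀ x : M, TangentSpace I x) : VectorField.mpullbackWithin 𝓘(ℝ, E) I
      (extChartAt I x).symm X (range I) = fieldInChart X x := by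
    rw [I.range_eq_univ, VectorField.mpullbackWithin_univ]
    rfl
  exact aux (hf X) (hf Y) (by rw [I.range_eq_univ, preimage_univ, univ_inter]) _

theorem IsSmoothFieldAt.mlieBracket [CompleteSpace E] {X Y : ∀ x : M, TangentSpace I x} {x : M}
    (hX : IsSmoothFieldAt X x) (hY : IsSmoothFieldAt Y x) :
    IsSmoothFieldAt (VectorField.mlieBracket I X Y) x := by
  have : IsManifold I (minSmoothness ℝ 2) M := by
    rw [minSmoothness_of_isRCLikeNormedField]
    exact .of_le (n := ∞) ENat.LEInfty.out
  have : IsManifold I ((⊤ : ℕ∞) + 1) M := by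
    simpa using! (inferInstance : IsManifold I ∞ M)
  have h := ContMDiffAt.mlieBracket_vectorField (m := ⊤) (n := ⊤) hX hY
    (by simp)
  exact h

/-- Lie brackets of related vector fields are related. -/
theorem mfderiv_mlieBracket_of_related [CompleteSpace E] [CompleteSpace E'] {f : M → M'}
    {X Y : ∀ x : M, TangentSpace I x} {X' Y' : ∀ x : M', TangentSpace I' x} {x : M}
    (hf : ContMDiffAt I I' ∞ f x) (hX : IsSmoothFieldAt X x) (hY : IsSmoothFieldAt Y x)
    (hX' : IsSmoothFieldAt X' (f x)) (hY' : IsSmoothFieldAt Y' (f x))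
    (hXX' : ∀ᶠ y in 𝓝 x, mfderiv I I' f y (X y) = X' (f y))
    (hYY' : ∀ᶠ y in 𝓝 x, mfderiv I I' f y (Y y) = Y' (f y)) :
    mfderiv I I' f x (VectorField.mlieBracket I X Y x) =
      VectorField.mlieBracket I' X' Y' (f x) := by
  have : IsManifold I 1 M := .of_le (n := ∞) (by simp)
  have : IsManifold I' 1 M' := .of_le (n := ∞) (by simp)
  set φ := extChartAt I x
  set ψ := extChartAt I' (f x)
  set z := φ x
  let fh : E → E' := fun z => ψ ((f ∘ φ.symm) z)
  have hzz : φ.symm z = x := extChartAt_to_inv x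
  have hc : ContinuousAt φ.symm z := continuousAt_extChartAt_symm x
  have hfs : ContMDiffAt 𝓘(ℝ, E) I' ∞ (f ∘ φ.symm) z := contMDiffAt_comp_extChartAt_symm hf
  have hsrc : (f ∘ φ.symm) z ∈ ψ.source := by
    rw [Function.comp_apply, hzz]; exact mem_extChartAt_source _
  have hfh : ContDiffAt ℝ ∞ fh z := contDiffAt_extChartAt_comp hfs hsrc
  have hfz : fh z = ψ (f x) := by simp only [fh, Function.comp_apply, hzz]
  -- Relatedness passes to chart expressions, where the vector-space statement applies.
  have hrel (X : ∀ x : M, TangentSpace I x) (X' : ∀ x : M', TangentSpace I' x)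
      (h : ∀ᶠ y in 𝓝 x, mfderiv I I' f y (X y) = X' (f y)) :
      ∀ᶠ y in 𝓝 z, fderiv ℝ fh y (fieldInChart X x y) = fieldInChart X' (f x) (fh y) := by
    have hd := hf.eventually_mdifferentiableAt
    rw [← hzz] at h hd
    filter_upwards [hc.eventually h, hc.eventually hd, extChartAt_target_mem_nhds (I := I) x,
      hfs.continuousAt.preimage_mem_nhds ((isOpen_extChartAt_source _).mem_nhds hsrc)]
      with y hy hyd hyt hys
    have hds : MDifferentiableAt 𝓘(ℝ, E) I φ.symm y :=
      (contMDiffAt_extChartAt_symm hyt).mdifferentiableAt (by simp)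
    refine (fderiv_extChartAt_comp (MDifferentiableAt.comp y hyd hds) hys _).trans ?_
    refine (congrArg _ ((mfderiv_comp_apply y hyd hds _).trans ((congrArg _
      (mfderiv_extChartAt_symm_fieldInChart X hyt)).trans hy))).trans ?_
    exact (fieldInChart_extChartAt X' hys).symm
  have key := fderiv_lieBracket_of_related hfh
    (hX.contDiffAt_fieldInChart_self.differentiableAt (by simp))
    (hY.contDiffAt_fieldInChart_self.differentiableAt (by simp))
    (X' := fieldInChart X' (f x)) (Y' := fieldInChart Y' (f x))
    (by rw [hfz]; exact hX'.contDiffAt_fieldInChart_self.differentiableAt (by simp))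
    (by rw [hfz]; exact hY'.contDiffAt_fieldInChart_self.differentiableAt (by simp))
    (hrel X X' hXX') (hrel Y Y' hYY')
  refine (isInvertible_mfderiv_extChartAt (mem_extChartAt_source (I := I') (f x))).injective ?_
  rw [mfderiv_extChartAt_mlieBracket]
  rw [hfz, ← mfderiv_extChartAt_mlieBracket] at key
  rw [← key]
  have hd : MDifferentiableAt I I' f (φ.symm z) := by
    rw [hzz]; exact hf.mdifferentiableAt (by simp)
  have hds : MDifferentiableAt 𝓘(ℝ, E) I φ.symm z :=
      (contMDiffAt_extChartAt_symm (mem_extChartAt_target x)).mdifferentiableAt (by simp)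
  refine Eq.symm ((fderiv_extChartAt_comp (MDifferentiableAt.comp z hd hds) hsrc _).trans ?_)
  refine (congrArg _ ((mfderiv_comp_apply z hd hds _).trans (congrArg _
    (mfderiv_extChartAt_symm_comp (mem_extChartAt_source x) _)))).trans ?_
  have h (y : M) (hy : y = x) (u : E) : (mfderiv I' 𝓘(ℝ, E') ψ (f y) (mfderiv I I' f y u) : E') =
      mfderiv I' 𝓘(ℝ, E') ψ (f x) (mfderiv I I' f x u) := by rw [hy]
  exact h _ hzz _

end Fields

/-! ### Contractions and the Courant bracket -/

section Contraction

variable {E : Type*} [NormedAddCommGroup E] [NormedSpace ℝ E] {H : Type*} [TopologicalSpace H]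
  {I : ModelWithCorners ℝ E H} {M : Type*} [TopologicalSpace M] [ChartedSpace H M]
  {E' : Type*} [NormedAddCommGroup E'] [NormedSpace ℝ E'] {H' : Type*} [TopologicalSpace H']
  {I' : ModelWithCorners ℝ E' H'} {M' : Type*} [TopologicalSpace M'] [ChartedSpace H' M']
  [I.Boundaryless] [I'.Boundaryless] [IsManifold I ∞ M] [IsManifold I' ∞ M']

open ContinuousAlternatingMap in
theorem formInChart_contract {n : ℕ} (X : ∀ x : M, TangentSpace I x) (α : DForm I M (n + 1))
    {x₀ : M} {z : E} (hz : z ∈ (extChartAt I x₀).target) :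
    formInChart I (contract I X α) x₀ z =
      curryLeft (formInChart I α x₀ z) (fieldInChart X x₀ z) := by
  rw [formInChart_eq_modelPullback, formInChart_eq_modelPullback]
  ext v
  refine DForm.apply_congr α rfl ?_
  have h := mfderiv_extChartAt_symm_fieldInChart X hz
  funext i
  refine Fin.cases ?_ (fun j => ?_) i
  · exact h.symm
  · rfl

open ContinuousAlternatingMap in
theorem formInChart_contract_eventuallyEq {n : ℕ} (X : ∀ x : M, TangentSpace I x)
    (α : DForm I M (n + 1)) (x : M) :
    formInChart I (contract I X α) x =ᶠ[𝓝 (extChartAt I x x)]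
      fun z => curryLeft (formInChart I α x z) (fieldInChart X x z) := by
  filter_upwards [extChartAt_target_mem_nhds (I := I) x] with z hz
  exact formInChart_contract X α hz

theorem IsSmoothFormAt.contract [CompleteSpace E] {n : ℕ} {X : ∀ x : M, TangentSpace I x}
    {α : DForm I M (n + 1)} {x : M} (hα : IsSmoothFormAt α x) (hX : IsSmoothFieldAt X x) :
    IsSmoothFormAt (contract I X α) x :=
  ContDiffAt.congr_of_eventuallyEq
    (ContDiffAt.curryLeft_apply hα hX.contDiffAt_fieldInChart_self)
    (formInChart_contract_eventuallyEq X α x)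

theorem IsSmoothFormAt.add {n : ℕ} {α β : DForm I M n} {x : M} (hα : IsSmoothFormAt α x)
    (hβ : IsSmoothFormAt β x) : IsSmoothFormAt (α + β) x :=
  ContDiffAt.add hα hβ

theorem IsSmoothFormAt.sub {n : ℕ} {α β : DForm I M n} {x : M} (hα : IsSmoothFormAt α x)
    (hβ : IsSmoothFormAt β x) : IsSmoothFormAt (α - β) x :=
  ContDiffAt.sub hα hβ

theorem IsSmoothFormAt.neg {n : ℕ} {α : DForm I M n} {x : M} (hα : IsSmoothFormAt α x) :
    IsSmoothFormAt (-α) x :=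
  ContDiffAt.neg hα

/-- The identity `L_X i_Y F - i_Y d i_X F = i_[X,Y] F + i_Y i_X dF` for a 2-form. -/
theorem mextDeriv_contraction_identity [CompleteSpace E] {X Y : ∀ x : M, TangentSpace I x}
    {F : DForm I M 2} (hF : ∀ x, IsSmoothFormAt F x) (hX : ∀ x, IsSmoothFieldAt X x)
    (hY : ∀ x, IsSmoothFieldAt Y x) :
    lieDerivForm I X (contract I Y F) - contract I Y (mextDeriv I (contract I X F))
      - contract I Y (contract I X (mextDeriv I F)) =
      contract I (VectorField.mlieBracket I X Y) F := by
  funext x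
  ext v
  let φ := extChartAt I x
  let z := φ x
  let D : TangentSpace I x → E := mfderiv I 𝓘(ℝ, E) φ x
  have hXz : fieldInChart X x z = D (X x) := fieldInChart_extChartAt X (mem_extChartAt_source x)
  have hYz : fieldInChart Y x z = D (Y x) := fieldInChart_extChartAt Y (mem_extChartAt_source x)
  have key := extDeriv_contraction_identity (F := formInChart I F x) (X := fieldInChart X x)
    (Y := fieldInChart Y x) (z := z) (ContDiffAt.differentiableAt (hF x) (by simp))
    ((hX x).contDiffAt_fieldInChart_self.differentiableAt (by simp))
    ((hY x).contDiffAt_fieldInChart_self.differentiableAt (by simp)) (D (v 0))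
  -- The facts `e1` to `e4` identify the terms of the identity at `x` with those of its vector-space
  -- version in the chart at `x`.
  have e1 : mextDeriv I (contract I X (contract I Y F)) x v =
      extDeriv (fun y => ContinuousAlternatingMap.curryLeft (ContinuousAlternatingMap.curryLeft
        (formInChart I F x y) (fieldInChart Y x y)) (fieldInChart X x y)) z ![D (v 0)] := by
    rw [mextDeriv_apply]
    have h : formInChart I (contract I X (contract I Y F)) x =ᶠ[𝓝 z]
        (fun y => ContinuousAlternatingMap.curryLeft (ContinuousAlternatingMap.curryLeft
        (formInChart I F x y) (fieldInChart Y x y)) (fieldInChart X x y)) := by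
      filter_upwards [extChartAt_target_mem_nhds (I := I) x] with z hz
      rw [formInChart_contract _ _ hz, formInChart_contract _ _ hz]
    rw [h.extDeriv_eq]
    exact congrArg _ (by funext i; fin_cases i; rfl)
  have e2 (X Y : ∀ x : M, TangentSpace I x) (hYz : fieldInChart Y x z = D (Y x)) :
      contract I Y (mextDeriv I (contract I X F)) x v =
      extDeriv (fun y => ContinuousAlternatingMap.curryLeft
        (formInChart I F x y) (fieldInChart X x y)) z ![fieldInChart Y x z, D (v 0)] := by
    refine (mextDeriv_apply (contract I X F) x (Fin.cons (Y x) v)).trans ?_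
    rw [(formInChart_contract_eventuallyEq X F x).extDeriv_eq, hYz]
    exact congrArg _ (by funext i; fin_cases i <;> rfl)
  have e3 : contract I Y (contract I X (mextDeriv I F)) x v =
      extDeriv (formInChart I F x) z ![fieldInChart X x z, fieldInChart Y x z, D (v 0)] := by
    refine (mextDeriv_apply F x (Fin.cons (X x) (Fin.cons (Y x) v))).trans ?_
    rw [hXz, hYz]
    exact congrArg _ (by funext i; fin_cases i <;> rfl)
  have e4 : contract I (VectorField.mlieBracket I X Y) F x v = formInChart I F x z
      ![VectorField.lieBracket ℝ (fieldInChart X x) (fieldInChart Y x) z, D (v 0)] := by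
    rw [← mfderiv_extChartAt_mlieBracket, formInChart_eq_modelPullback]
    refine DForm.apply_congr F (extChartAt_to_inv (I := I) x).symm ?_
    have h := mfderiv_extChartAt_symm_comp (I := I) (mem_extChartAt_source (I := I) x)
    funext i
    fin_cases i
    · exact (h _).symm
    · exact (h _).symm
  rw [e4, ← key, ← e1, ← e2 Y X hXz, ← e2 X Y hYz, ← e3]
  rfl

/-- Contractions with related fields commute with pullback. -/
theorem pullbackForm_contract {n : ℕ} {f : M → M'} {X : ∀ x : M, TangentSpace I x}
    {X' : ∀ x : M', TangentSpace I' x} (α : DForm I' M' (n + 1))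
    (h : ∀ x, mfderiv I I' f x (X x) = X' (f x)) :
    pullbackForm I I' f (contract I' X' α) = contract I X (pullbackForm I I' f α) := by
  funext x
  ext v
  refine DForm.apply_congr α rfl ?_
  funext i
  refine Fin.cases ?_ (fun j => ?_) i
  · exact (h x).symm
  · rfl

theorem contract_sub {n : ℕ} (X : ∀ x : M, TangentSpace I x) (α β : DForm I M (n + 1)) :
    contract I X (α - β) = contract I X α - contract I X β := rfl

theorem mextDeriv_pullbackForm {n : ℕ} {f : M → M'} {α : DForm I' M' n}
    (hα : ∀ x, IsSmoothFormAt α x) (hf : ContMDiff I I' ∞ f) :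
    mextDeriv I (pullbackForm I I' f α) = pullbackForm I I' f (mextDeriv I' α) :=
  funext fun x => mextDeriv_pullbackForm_apply (hα (f x)) (hf x)

variable (I) in
/-- The covector part of the Courant bracket. -/
noncomputable def courantForm (h : DForm I M 3) (X Y : ∀ x : M, TangentSpace I x)
    (a b : DForm I M 1) : DForm I M 1 :=
  lieDerivForm I X b - contract I Y (mextDeriv I a) - contract I Y (contract I X h)

theorem courantBracket_snd (h : DForm I M 3) (v w : GenSection I M) :
    (fun x => (courantBracket I h v w x).2) = courantForm I h (fun y => (v y).1)
      (fun y => (w y).1) (fun y => (v y).2) (fun y => (w y).2) := rfl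

theorem IsSmoothFormAt.courantForm [FiniteDimensional ℝ E] {h : DForm I M 3}
    {X Y : ∀ x : M, TangentSpace I x} {a b : DForm I M 1} (hh : ∀ x, IsSmoothFormAt h x)
    (hX : ∀ x, IsSmoothFieldAt X x) (hY : ∀ x, IsSmoothFieldAt Y x)
    (ha : ∀ x, IsSmoothFormAt a x) (hb : ∀ x, IsSmoothFormAt b x) (x : M) :
    IsSmoothFormAt (courantForm I h X Y a b) x := by
  have : CompleteSpace E := FiniteDimensional.complete ℝ E
  refine ((IsSmoothFormAt.add (IsSmoothFormAt.mextDeriv (fun y => (hb y).contract (hX y)) x)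
    ((IsSmoothFormAt.mextDeriv hb x).contract (hX x))).sub ?_).sub ?_
  · exact (IsSmoothFormAt.mextDeriv ha x).contract (hY x)
  · exact ((hh x).contract (hX x)).contract (hY x)

/-- Only exterior derivatives and contractions with related fields enter, and both commute with
pullback. Of the two fields only X' is differentiated, inside the Lie derivative, so only its
smoothness is required. -/
theorem pullbackForm_courantForm [CompleteSpace E'] {f : M → M'} (hf : ContMDiff I I' ∞ f)
    {h : DForm I' M' 3}
    {X Y : ∀ x : M, TangentSpace I x} {X' Y' : ∀ x : M', TangentSpace I' x} {a b : DForm I' M' 1}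
    (hX : ∀ x, IsSmoothFieldAt X' x) (ha : ∀ x, IsSmoothFormAt a x) (hb : ∀ x, IsSmoothFormAt b x)
    (hXX' : ∀ x, mfderiv I I' f x (X x) = X' (f x))
    (hYY' : ∀ x, mfderiv I I' f x (Y x) = Y' (f x)) :
    pullbackForm I I' f (courantForm I' h X' Y' a b) = courantForm I (pullbackForm I I' f h) X Y
      (pullbackForm I I' f a) (pullbackForm I I' f b) := by
  have e : pullbackForm I I' f (courantForm I' h X' Y' a b) =
      pullbackForm I I' f (mextDeriv I' (contract I' X' b))
      + pullbackForm I I' f (contract I' X' (mextDeriv I' b))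
      - pullbackForm I I' f (contract I' Y' (mextDeriv I' a))
      - pullbackForm I I' f (contract I' Y' (contract I' X' h)) := rfl
  rw [e, ← mextDeriv_pullbackForm (fun y => (hb y).contract (hX y)) hf,
    pullbackForm_contract _ hXX', pullbackForm_contract _ hXX', pullbackForm_contract _ hYY',
    pullbackForm_contract _ hYY', pullbackForm_contract _ hXX', ← mextDeriv_pullbackForm hb hf,
    ← mextDeriv_pullbackForm ha hf]
  rfl

/-- The effect of a `B`-field transform on the covector part of the Courant bracket. -/
theorem courantForm_sub_contract [CompleteSpace E] {h : DForm I M 3}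
    {X Y : ∀ x : M, TangentSpace I x} {a b : DForm I M 1} {F : DForm I M 2}
    (hF : ∀ x, IsSmoothFormAt F x) (hX : ∀ x, IsSmoothFieldAt X x)
    (hY : ∀ x, IsSmoothFieldAt Y x) (ha : ∀ x, IsSmoothFormAt a x)
    (hb : ∀ x, IsSmoothFormAt b x) :
    courantForm I (h - mextDeriv I F) X Y (a - contract I X F) (b - contract I Y F) =
      courantForm I h X Y a b - contract I (VectorField.mlieBracket I X Y) F := by
  have hXF := fun x => (hF x).contract (hX x)
  have hYF := fun x => (hF x).contract (hY x)
  have e1 : mextDeriv I (a - contract I X F) = mextDeriv I a - mextDeriv I (contract I X F) :=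
    funext fun x => mextDeriv_sub (ha x) (hXF x)
  have e2 : mextDeriv I (b - contract I Y F) = mextDeriv I b - mextDeriv I (contract I Y F) :=
    funext fun x => mextDeriv_sub (hb x) (hYF x)
  have e3 : mextDeriv I (contract I X (b - contract I Y F)) =
      mextDeriv I (contract I X b) - mextDeriv I (contract I X (contract I Y F)) := by
    rw [contract_sub]
    exact funext fun x => mextDeriv_sub ((hb x).contract (hX x)) ((hYF x).contract (hX x))
  -- The letters q, s, u, w stand for the terms containing F; their combination on the right is the
  -- left side of `mextDeriv_contraction_identity`.
  have key {A : Type _} [AddCommGroup A] (p q r s t u v w : A) :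
      p - q + (r - s) - (t - u) - (v - w) = p + r - t - v - (q + s - u - w) := by abel
  rw [← mextDeriv_contraction_identity hF hX hY, courantForm, courantForm, lieDerivForm,
    lieDerivForm, lieDerivForm, e1, e2, e3, contract_sub, contract_sub, contract_sub, contract_sub]
  exact key _ _ _ _ _ _ _ _

end Contraction

/-! ### Linear algebra of T-duality -/

section Linear

variable {T V W : Type*} [NormedAddCommGroup T] [NormedSpace ℝ T]
  [NormedAddCommGroup V] [NormedSpace ℝ V] [NormedAddCommGroup W] [NormedSpace ℝ W]

theorem ContinuousAlternatingMap.map_swap_two (Ω : T [⋀^Fin 2]→L[ℝ] ℝ) (u v : T) :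
    Ω ![u, v] = - Ω ![v, u] := by
  refine Eq.trans ?_ (Ω.map_swap ![v, u] (i := 0) (j := 1) (by simp))
  exact congrArg Ω (by ext i; fin_cases i <;> rfl)

/-- A 1-form as a linear functional. -/
noncomputable def oneFormToDual : (T [⋀^Fin 1]→L[ℝ] ℝ) →L[ℝ] T →L[ℝ] ℝ :=
  ((ContinuousAlternatingMap.ofSubsingletonLIE (𝕜 := ℝ) (E := T) (F := ℝ)
    (0 : Fin 1)).symm.toContinuousLinearEquiv : (T [⋀^Fin 1]→L[ℝ] ℝ) →L[ℝ] T →L[ℝ] ℝ)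

/-- A 2-form as a map to the dual space. -/
noncomputable def twoFormToDual : (T [⋀^Fin 2]→L[ℝ] ℝ) →L[ℝ] T →L[ℝ] T →L[ℝ] ℝ :=
  (ContinuousLinearMap.compL ℝ T (T [⋀^Fin 1]→L[ℝ] ℝ) (T →L[ℝ] ℝ) oneFormToDual) ∘L
    (ContinuousAlternatingMap.curryLeftLI (𝕜 := ℝ) (E := T) (F := ℝ)
      (n := 1)).toContinuousLinearMap

theorem twoFormToDual_apply (Ω : T [⋀^Fin 2]→L[ℝ] ℝ) (u v : T) :
    twoFormToDual Ω u v = Ω ![u, v] := by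
  have h : twoFormToDual Ω u v = Ω (Fin.cons u fun _ => v) := rfl
  rw [h]
  congr 1
  ext i
  fin_cases i <;> rfl

theorem finrank_continuousDual [FiniteDimensional ℝ T] :
    Module.finrank ℝ (T →L[ℝ] ℝ) = Module.finrank ℝ T := by
  rw [← (LinearMap.toContinuousLinearMap (𝕜 := ℝ) (E := T) (F' := ℝ)).finrank_eq]
  exact Subspace.dual_finrank_eq

/-- The linear map whose inverse computes the T-dual of a vector: `(X, β) ↦ (P X, Ω(X) + β ∘ Q)`. -/
noncomputable def dualitySystem (P : T →L[ℝ] V) (Q : T →L[ℝ] W) (Ω : T [⋀^Fin 2]→L[ℝ] ℝ) :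
    (T × (W →L[ℝ] ℝ)) →L[ℝ] (V × (T →L[ℝ] ℝ)) :=
  .inl ℝ V (T →L[ℝ] ℝ) ∘L P ∘L .fst ℝ T (W →L[ℝ] ℝ) +
    .inr ℝ V (T →L[ℝ] ℝ) ∘L (twoFormToDual Ω ∘L .fst ℝ T (W →L[ℝ] ℝ) +
      (ContinuousLinearMap.compL ℝ T W ℝ).flip Q ∘L .snd ℝ T (W →L[ℝ] ℝ))

theorem dualitySystem_apply (P : T →L[ℝ] V) (Q : T →L[ℝ] W) (Ω : T [⋀^Fin 2]→L[ℝ] ℝ)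
    (X : T) (β : W →L[ℝ] ℝ) :
    dualitySystem P Q Ω (X, β) = (P X, twoFormToDual Ω X + β ∘L Q) := by
  simp [dualitySystem]

/-- If (X, β) is sent to zero, then X lies in ker P and Ω(X, ·) = -β ∘ Q vanishes on ker Q, so X = 0
by nondegeneracy and β = 0 by surjectivity of Q. A dimension count then turns injectivity into
invertibility. -/
theorem isInvertible_dualitySystem [FiniteDimensional ℝ T] [FiniteDimensional ℝ V]
    [FiniteDimensional ℝ W] {P : T →L[ℝ] V} {Q : T →L[ℝ] W} {Ω : T [⋀^Fin 2]→L[ℝ] ℝ}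
    (hP : Function.Surjective P) (hQ : Function.Surjective Q)
    (hl : ∀ Y, Q Y = 0 → (∀ Z, P Z = 0 → Ω ![Y, Z] = 0) → Y = 0)
    (hr : ∀ Z, P Z = 0 → (∀ Y, Q Y = 0 → Ω ![Y, Z] = 0) → Z = 0) :
    (dualitySystem P Q Ω).IsInvertible := by
  -- The pairing embeds each kernel into the dual of the other.
  have hker : Module.finrank ℝ (LinearMap.ker P.toLinearMap) =
      Module.finrank ℝ (LinearMap.ker Q.toLinearMap) := by
    let b : LinearMap.ker Q.toLinearMap →ₗ[ℝ] LinearMap.ker P.toLinearMap →ₗ[ℝ] ℝ :=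
      LinearMap.mk₂ ℝ (fun Y Z => twoFormToDual Ω Y.1 Z.1) (by simp) (by simp) (by simp) (by simp)
    have h1 : Function.Injective b := by
      refine (injective_iff_map_eq_zero b).2 fun Y hY => Subtype.ext (hl Y.1 Y.2 fun Z hZ => ?_)
      rw [← twoFormToDual_apply]
      exact congrArg (fun f => f ⟨Z, hZ⟩) hY
    have h2 : Function.Injective b.flip := by
      refine (injective_iff_map_eq_zero b.flip).2 fun Z hZ => Subtype.ext
        (hr Z.1 Z.2 fun Y hY => ?_)
      rw [← twoFormToDual_apply]
      exact congrArg (fun f => f ⟨Y, hY⟩) hZ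
    have h3 := LinearMap.finrank_le_finrank_of_injective h1
    have h4 := LinearMap.finrank_le_finrank_of_injective h2
    have e (U : Type _) [AddCommGroup U] [Module ℝ U] [FiniteDimensional ℝ U] :
        Module.finrank ℝ (U →ₗ[ℝ] ℝ) = Module.finrank ℝ U := Subspace.dual_finrank_eq
    rw [e] at h3 h4
    exact le_antisymm h4 h3
  have hinj : Function.Injective (dualitySystem P Q Ω) := by
    refine (injective_iff_map_eq_zero _).2 ?_
    rintro ⟨X, β⟩ h
    rw [dualitySystem_apply] at h
    have h1 : P X = 0 := congrArg Prod.fst h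
    have h2 (Y : T) : Ω ![X, Y] + β (Q Y) = 0 := by
      rw [← twoFormToDual_apply]
      exact congrArg (fun f => f.2 Y) h
    have h3 : X = 0 := by
      refine hr X h1 fun Y hY => ?_
      have := h2 Y
      rw [hY, map_zero, add_zero] at this
      rw [ContinuousAlternatingMap.map_swap_two, this, neg_zero]
    have h4 : β = 0 := by
      ext y
      obtain ⟨Y, rfl⟩ := hQ y
      have := h2 Y
      rw [h3, ← twoFormToDual_apply] at this
      simpa using this
    rw [h3, h4]
    rfl
  -- Both are quotients of `T` by kernels of the same dimension.
  have hVW : Module.finrank ℝ V = Module.finrank ℝ W := by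
    have h1 := P.toLinearMap.finrank_range_add_finrank_ker
    have h2 := Q.toLinearMap.finrank_range_add_finrank_ker
    rw [LinearMap.range_eq_top.2 hP, finrank_top] at h1
    rw [LinearMap.range_eq_top.2 hQ, finrank_top] at h2
    omega
  have hfin : Module.finrank ℝ (T × (W →L[ℝ] ℝ)) = Module.finrank ℝ (V × (T →L[ℝ] ℝ)) := by
    rw [Module.finrank_prod, Module.finrank_prod, finrank_continuousDual, finrank_continuousDual,
      hVW, add_comm]
  exact ⟨(LinearEquiv.ofInjectiveOfFinrankEq (dualitySystem P Q Ω).toLinearMap hinj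
    hfin).toContinuousLinearEquiv, rfl⟩

theorem contDiff_twoFormToDual :
    ContDiff ℝ ∞ (fun Ω : T [⋀^Fin 2]→L[ℝ] ℝ => twoFormToDual Ω) :=
  contDiff_const.clm_comp (contDiff_curryLeft 1)

set_option synthInstance.maxHeartbeats 100000 in
theorem contDiff_precomp :
    ContDiff ℝ ∞ (fun Q : T →L[ℝ] W => (ContinuousLinearMap.compL ℝ T W ℝ).flip Q) :=
  ContinuousLinearMap.contDiff (𝕜 := ℝ) (E := T →L[ℝ] W) (F := (W →L[ℝ] ℝ) →L[ℝ] T →L[ℝ] ℝ)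
    (ContinuousLinearMap.compL ℝ T W ℝ).flip

theorem ContDiffAt.dualitySystem {E : Type*} [NormedAddCommGroup E] [NormedSpace ℝ E]
    {P : E → T →L[ℝ] V} {Q : E → T →L[ℝ] W} {Ω : E → T [⋀^Fin 2]→L[ℝ] ℝ} {z : E}
    (hP : ContDiffAt ℝ ∞ P z) (hQ : ContDiffAt ℝ ∞ Q z) (hΩ : ContDiffAt ℝ ∞ Ω z) :
    ContDiffAt ℝ ∞ (fun y => dualitySystem (P y) (Q y) (Ω y)) z := by
  have h1 : ContDiffAt ℝ ∞ (fun y => twoFormToDual (Ω y)) z :=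
    contDiff_twoFormToDual.contDiffAt.comp z hΩ
  have h2 : ContDiffAt ℝ ∞ (fun y => (ContinuousLinearMap.compL ℝ T W ℝ).flip (Q y)) z :=
    contDiff_precomp.contDiffAt.comp z hQ
  exact (contDiffAt_const.clm_comp (hP.clm_comp contDiffAt_const)).add
    (contDiffAt_const.clm_comp ((h1.clm_comp contDiffAt_const).add (h2.clm_comp contDiffAt_const)))

end Linear

section LinearDuality

variable {T V W : Type*} [NormedAddCommGroup T] [NormedSpace ℝ T]
  [NormedAddCommGroup V] [NormedSpace ℝ V] [NormedAddCommGroup W] [NormedSpace ℝ W]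
  {T' V' W' : Type*} [NormedAddCommGroup T'] [NormedSpace ℝ T']
  [NormedAddCommGroup V'] [NormedSpace ℝ V'] [NormedAddCommGroup W'] [NormedSpace ℝ W']

/-- Surjections `P`, `Q` and a 2-form pairing their kernels nondegenerately. -/
structure IsDualTriple (P : T →L[ℝ] V) (Q : T →L[ℝ] W) (Ω : T [⋀^Fin 2]→L[ℝ] ℝ) : Prop where
  surjective_left : Function.Surjective P
  surjective_right : Function.Surjective Q
  nondegenerate_left : ∀ Y, Q Y = 0 → (∀ Z, P Z = 0 → Ω ![Y, Z] = 0) → Y = 0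
  nondegenerate_right : ∀ Z, P Z = 0 → (∀ Y, Q Y = 0 → Ω ![Y, Z] = 0) → Z = 0

/-- A lift of `v = X + ξ` along `P` for which the covector `P^* ξ - Ω(X)` vanishes on `ker Q`. -/
def IsLinearLift (P : T →L[ℝ] V) (Q : T →L[ℝ] W) (Ω : T [⋀^Fin 2]→L[ℝ] ℝ)
    (v : V × (V [⋀^Fin 1]→L[ℝ] ℝ)) (X : T) : Prop :=
  P X = v.1 ∧ ∀ Y, Q Y = 0 → v.2 (fun _ => P Y) - Ω ![X, Y] = 0

/-- The linear T-duality relation between `V ⊕ V*` and `W ⊕ W*`. -/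
def IsLinearDual (P : T →L[ℝ] V) (Q : T →L[ℝ] W) (Ω : T [⋀^Fin 2]→L[ℝ] ℝ)
    (v : V × (V [⋀^Fin 1]→L[ℝ] ℝ)) (w : W × (W [⋀^Fin 1]→L[ℝ] ℝ)) : Prop :=
  ∃ X, P X = v.1 ∧ Q X = w.1 ∧ ∀ Y, w.2 (fun _ => Q Y) = v.2 (fun _ => P Y) - Ω ![X, Y]

variable {P : T →L[ℝ] V} {Q : T →L[ℝ] W} {Ω : T [⋀^Fin 2]→L[ℝ] ℝ}
  {P' : T' →L[ℝ] V'} {Q' : T' →L[ℝ] W'} {Ω' : T' [⋀^Fin 2]→L[ℝ] ℝ}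

theorem ContinuousAlternatingMap.map_zero_one (b : W [⋀^Fin 1]→L[ℝ] ℝ) : b (fun _ => 0) = 0 :=
  b.map_coord_zero (0 : Fin 1) rfl

theorem ContinuousAlternatingMap.ext_one {b b' : W [⋀^Fin 1]→L[ℝ] ℝ}
    (h : ∀ u, b (fun _ => u) = b' (fun _ => u)) : b = b' := by
  ext u
  have hu : u = fun _ => u 0 := by
    funext i
    rw [Subsingleton.elim i 0]
  rw [hu]
  exact h _

/-- The sign is immaterial for nondegeneracy. It is chosen because solving the covector equation of
`IsLinearDual` for the other covector changes the sign of Ω. -/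
theorem IsDualTriple.symm (h : IsDualTriple P Q Ω) : IsDualTriple Q P (-Ω) where
  surjective_left := h.surjective_right
  surjective_right := h.surjective_left
  nondegenerate_left Y hY hZ := h.nondegenerate_right Y hY fun Z hZ' => by
    rw [ContinuousAlternatingMap.map_swap_two]
    exact hZ Z hZ'
  nondegenerate_right Z hZ hY := h.nondegenerate_left Z hZ fun Y hY' => by
    rw [ContinuousAlternatingMap.map_swap_two]
    exact hY Y hY'

theorem IsLinearDual.symm {v : V × (V [⋀^Fin 1]→L[ℝ] ℝ)} {w : W × (W [⋀^Fin 1]→L[ℝ] ℝ)}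
    (h : IsLinearDual P Q Ω v w) : IsLinearDual Q P (-Ω) w v := by
  obtain ⟨X, h1, h2, h3⟩ := h
  refine ⟨X, h2, h1, fun Y => ?_⟩
  rw [h3, ContinuousAlternatingMap.neg_apply]
  ring

theorem isLinearDual_symm_iff {v : V × (V [⋀^Fin 1]→L[ℝ] ℝ)} {w : W × (W [⋀^Fin 1]→L[ℝ] ℝ)} :
    IsLinearDual Q P (-Ω) w v ↔ IsLinearDual P Q Ω v w :=
  ⟨fun h => by simpa using h.symm, fun h => h.symm⟩

theorem IsLinearDual.add {v v₂ : V × (V [⋀^Fin 1]→L[ℝ] ℝ)} {w w₂ : W × (W [⋀^Fin 1]→L[ℝ] ℝ)}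
    (h : IsLinearDual P Q Ω v w) (h₂ : IsLinearDual P Q Ω v₂ w₂) :
    IsLinearDual P Q Ω (v + v₂) (w + w₂) := by
  obtain ⟨X, h1, h2, h3⟩ := h
  obtain ⟨Y, k1, k2, k3⟩ := h₂
  refine ⟨X + Y, by simp [h1, k1], by simp [h2, k2], fun Z => ?_⟩
  have e := h3 Z
  have e' := k3 Z
  rw [← twoFormToDual_apply] at e e' ⊢
  simp only [Prod.snd_add, ContinuousAlternatingMap.add_apply, map_add,
    _root_.add_apply]
  linarith

theorem IsLinearDual.smul {v : V × (V [⋀^Fin 1]→L[ℝ] ℝ)} {w : W × (W [⋀^Fin 1]→L[ℝ] ℝ)}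
    (r : ℝ) (h : IsLinearDual P Q Ω v w) : IsLinearDual P Q Ω (r • v) (r • w) := by
  obtain ⟨X, h1, h2, h3⟩ := h
  refine ⟨r • X, by simp [h1], by simp [h2], fun Z => ?_⟩
  have e := h3 Z
  rw [← twoFormToDual_apply] at e ⊢
  simp only [Prod.smul_snd, ContinuousAlternatingMap.smul_apply, map_smul,
    _root_.smul_apply, smul_eq_mul, e]
  ring

/-- The T-duality relation preserves the natural pairing. -/
theorem IsLinearDual.pairing_eq {v v₂ : V × (V [⋀^Fin 1]→L[ℝ] ℝ)}
    {w w₂ : W × (W [⋀^Fin 1]→L[ℝ] ℝ)}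
    (h : IsLinearDual P Q Ω v w) (h₂ : IsLinearDual P Q Ω v₂ w₂) :
    w₂.2 (fun _ => w.1) + w.2 (fun _ => w₂.1) = v₂.2 (fun _ => v.1) + v.2 (fun _ => v₂.1) := by
  obtain ⟨X, h1, h2, h3⟩ := h
  obtain ⟨Y, k1, k2, k3⟩ := h₂
  -- The two corrections Ω(X, Y) and Ω(Y, X) cancel.
  rw [← h1, ← h2, ← k1, ← k2, h3, k3, ContinuousAlternatingMap.map_swap_two Ω X Y]
  ring

/-- The image under G of the old lift is the new one. Surjectivity of G is what allows every test
vector to be pulled back to the old triple. The intended G is the differential of a symmetry of the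
correspondence. -/
theorem IsLinearDual.map {G : T' →L[ℝ] T} {A : V' →L[ℝ] V} {B : W' →L[ℝ] W}
    (hG : Function.Surjective G) (hP : ∀ u, P (G u) = A (P' u)) (hQ : ∀ u, Q (G u) = B (Q' u))
    (hΩ : ∀ u z, Ω ![G u, G z] = Ω' ![u, z])
    {v' : V' × (V' [⋀^Fin 1]→L[ℝ] ℝ)} {w' : W' × (W' [⋀^Fin 1]→L[ℝ] ℝ)}
    {v : V × (V [⋀^Fin 1]→L[ℝ] ℝ)} {w : W × (W [⋀^Fin 1]→L[ℝ] ℝ)}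
    (hv₁ : A v'.1 = v.1) (hv₂ : ∀ u, v.2 (fun _ => A u) = v'.2 (fun _ => u))
    (hw₁ : B w'.1 = w.1) (hw₂ : ∀ u, w.2 (fun _ => B u) = w'.2 (fun _ => u))
    (h : IsLinearDual P' Q' Ω' v' w') : IsLinearDual P Q Ω v w := by
  obtain ⟨X, h1, h2, h3⟩ := h
  refine ⟨G X, by rw [hP, h1, hv₁], by rw [hQ, h2, hw₁], fun Z => ?_⟩
  obtain ⟨Y, rfl⟩ := hG Z
  rw [hP, hQ, hv₂, hw₂, hΩ, h3]

/-- This moves lifts into charts. Test vectors travel forward along G, so injectivity of B is enough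
to keep them in the kernel. -/
theorem IsLinearLift.comap {G : T' →L[ℝ] T} {A : V →L[ℝ] V'} {B : W →L[ℝ] W'}
    (hB : Function.Injective B) (hP : ∀ u, P' u = A (P (G u))) (hQ : ∀ u, Q' u = B (Q (G u)))
    (hΩ : ∀ u z, Ω' ![u, z] = Ω ![G u, G z])
    {v : V × (V [⋀^Fin 1]→L[ℝ] ℝ)} {v' : V' × (V' [⋀^Fin 1]→L[ℝ] ℝ)}
    (hv₁ : v'.1 = A v.1) (hv₂ : ∀ u, v'.2 (fun _ => A u) = v.2 (fun _ => u)) {X : T'}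
    (h : IsLinearLift P Q Ω v (G X)) : IsLinearLift P' Q' Ω' v' X := by
  refine ⟨by rw [hP, h.1, hv₁], fun Y hY => ?_⟩
  rw [hP, hv₂, hΩ]
  refine h.2 _ (hB ?_)
  rw [← hQ, hY, map_zero]

theorem IsDualTriple.comap {G : T' →L[ℝ] T} {A : V →L[ℝ] V'} {B : W →L[ℝ] W'}
    (hG : Function.Bijective G) (hA : Function.Bijective A) (hB : Function.Bijective B)
    (hP : ∀ u, P' u = A (P (G u))) (hQ : ∀ u, Q' u = B (Q (G u)))
    (hΩ : ∀ u z, Ω' ![u, z] = Ω ![G u, G z]) (h : IsDualTriple P Q Ω) :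
    IsDualTriple P' Q' Ω' := by
  have hP0 (u : T') : P' u = 0 ↔ P (G u) = 0 := by rw [hP, map_eq_zero_iff A hA.1]
  have hQ0 (u : T') : Q' u = 0 ↔ Q (G u) = 0 := by rw [hQ, map_eq_zero_iff B hB.1]
  refine ⟨?_, ?_, fun Y hY hZ => ?_, fun Z hZ hY => ?_⟩
  · rw [show ⇑P' = A ∘ P ∘ G from funext hP]
    exact hA.2.comp (h.surjective_left.comp hG.2)
  · rw [show ⇑Q' = B ∘ Q ∘ G from funext hQ]
    exact hB.2.comp (h.surjective_right.comp hG.2)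
  · refine (map_eq_zero_iff G hG.1).1 (h.nondegenerate_left _ ((hQ0 Y).1 hY) fun Z hZ' => ?_)
    obtain ⟨Z, rfl⟩ := hG.2 Z
    rw [← hΩ]
    exact hZ Z ((hP0 Z).2 hZ')
  · refine (map_eq_zero_iff G hG.1).1 (h.nondegenerate_right _ ((hP0 Z).1 hZ) fun Y hY' => ?_)
    obtain ⟨Y, rfl⟩ := hG.2 Y
    rw [← hΩ]
    exact hY Y ((hQ0 Y).2 hY')

/-- The difference of two lifts lies in ker P and pairs to zero with ker Q. -/
theorem IsLinearLift.unique (h : IsDualTriple P Q Ω) {v : V × (V [⋀^Fin 1]→L[ℝ] ℝ)} {X Y : T}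
    (hX : IsLinearLift P Q Ω v X) (hY : IsLinearLift P Q Ω v Y) : X = Y := by
  refine sub_eq_zero.1 (h.nondegenerate_right _ (by rw [map_sub, hX.1, hY.1, sub_self])
    fun Z hZ => ?_)
  have h1 := hX.2 Z hZ
  have h2 := hY.2 Z hZ
  rw [ContinuousAlternatingMap.map_swap_two]
  rw [← twoFormToDual_apply] at h1 h2 ⊢
  rw [map_sub, _root_.sub_apply]
  linarith

/-- The basic condition comes for free: a covector pulled back along Q vanishes on ker Q. -/
theorem IsLinearDual.exists_lift {v : V × (V [⋀^Fin 1]→L[ℝ] ℝ)} {w : W × (W [⋀^Fin 1]→L[ℝ] ℝ)}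
    (h : IsLinearDual P Q Ω v w) : ∃ X, IsLinearLift P Q Ω v X ∧ w.1 = Q X ∧
      ∀ Y, w.2 (fun _ => Q Y) = v.2 (fun _ => P Y) - Ω ![X, Y] := by
  obtain ⟨X, h1, h2, h3⟩ := h
  refine ⟨X, ⟨h1, fun Y hY => ?_⟩, h2.symm, h3⟩
  rw [← h3, hY, ContinuousAlternatingMap.map_zero_one]

theorem IsLinearDual.unique (h : IsDualTriple P Q Ω) {v : V × (V [⋀^Fin 1]→L[ℝ] ℝ)}
    {w w₂ : W × (W [⋀^Fin 1]→L[ℝ] ℝ)} (hw : IsLinearDual P Q Ω v w)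
    (hw₂ : IsLinearDual P Q Ω v w₂) : w = w₂ := by
  obtain ⟨X, hX, h1, h2⟩ := hw.exists_lift
  obtain ⟨Y, hY, k1, k2⟩ := hw₂.exists_lift
  obtain rfl := hX.unique h hY
  refine Prod.ext (h1.trans k1.symm) (ContinuousAlternatingMap.ext_one fun u => ?_)
  obtain ⟨Z, rfl⟩ := h.surjective_right u
  rw [h2, k2]

variable [FiniteDimensional ℝ T] [FiniteDimensional ℝ V] [FiniteDimensional ℝ W]

theorem IsDualTriple.isInvertible (h : IsDualTriple P Q Ω) : (dualitySystem P Q Ω).IsInvertible :=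
  isInvertible_dualitySystem h.surjective_left h.surjective_right h.nondegenerate_left
    h.nondegenerate_right

/-- Solving the system with right-hand side (X, P^*ξ) produces the lift together with a covector on
`W`, which is the dual covector. -/
theorem IsDualTriple.exists_dual (h : IsDualTriple P Q Ω) (v : V × (V [⋀^Fin 1]→L[ℝ] ℝ)) :
    ∃ w, IsLinearDual P Q Ω v w := by
  obtain ⟨⟨X, β⟩, hX⟩ := h.isInvertible.bijective.2 (v.1, oneFormToDual v.2 ∘L P)
  rw [dualitySystem_apply] at hX
  refine ⟨(Q X, ContinuousAlternatingMap.ofSubsingleton ℝ W ℝ (0 : Fin 1) β), X,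
    congrArg Prod.fst hX, rfl, fun Y => ?_⟩
  have h2 : twoFormToDual Ω X Y + β (Q Y) = v.2 (fun _ => P Y) := congrArg (fun f => f.2 Y) hX
  rw [← h2, twoFormToDual_apply, add_sub_cancel_left]
  rfl

theorem IsDualTriple.existsUnique_lift (h : IsDualTriple P Q Ω) (v : V × (V [⋀^Fin 1]→L[ℝ] ℝ)) :
    ∃! X, IsLinearLift P Q Ω v X := by
  obtain ⟨w, hw⟩ := h.exists_dual v
  obtain ⟨X, hX, -⟩ := hw.exists_lift
  exact ⟨X, hX, fun Y hY => hY.unique h hX⟩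

/-- This closed formula is the source of smoothness: inversion of operators is smooth, so the lift
varies smoothly with the data. -/
theorem IsLinearLift.eq_inverse (h : IsDualTriple P Q Ω) {v : V × (V [⋀^Fin 1]→L[ℝ] ℝ)} {X : T}
    (hX : IsLinearLift P Q Ω v X) :
    X = ((dualitySystem P Q Ω).inverse (v.1, oneFormToDual v.2 ∘L P)).1 := by
  have hi := h.isInvertible.self_apply_inverse (v.1, oneFormToDual v.2 ∘L P)
  set y := (dualitySystem P Q Ω).inverse (v.1, oneFormToDual v.2 ∘L P) with hy
  rw [← Prod.mk.eta (p := y), dualitySystem_apply] at hi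
  refine hX.unique h ⟨congrArg Prod.fst hi, fun Y hY => ?_⟩
  have h2 : twoFormToDual Ω y.1 Y + y.2 (Q Y) = v.2 (fun _ => P Y) := congrArg (fun f => f.2 Y) hi
  rw [← h2, hY, map_zero, add_zero, twoFormToDual_apply, sub_self]

end LinearDuality

/-- A linear relation that is bijective is a linear equivalence. -/
theorem exists_linearEquiv_of_relation {V W : Type*} [AddCommGroup V] [Module ℝ V]
    [AddCommGroup W] [Module ℝ W] {R : V → W → Prop}
    (hadd : ∀ v w v' w', R v w → R v' w' → R (v + v') (w + w'))
    (hsmul : ∀ (r : ℝ) v w, R v w → R (r • v) (r • w))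
    (hl : ∀ v, ∃ w, R v w) (hr : ∀ w, ∃ v, R v w)
    (hlu : ∀ v w w', R v w → R v w' → w = w') (hru : ∀ v v' w, R v w → R v' w → v = v') :
    ∃ φ : V ≃ₗ[ℝ] W, ∀ v w, φ v = w ↔ R v w := by
  choose f hf using hl
  have hfw (v : V) (w : W) : f v = w ↔ R v w :=
    ⟨fun h => h ▸ hf v, fun h => hlu v _ _ (hf v) h⟩
  let F : V →ₗ[ℝ] W :=
    { toFun := f
      map_add' := fun v w => (hfw _ _).2 (hadd _ _ _ _ (hf v) (hf w))
      map_smul' := fun r v => (hfw _ _).2 (hsmul r _ _ (hf v)) }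
  refine ⟨LinearEquiv.ofBijective F ⟨fun v v' h => hru v v' (f v) (hf v) ?_, fun w => ?_⟩, hfw⟩
  · have h' : f v = f v' := h
    rw [h']
    exact hf v'
  · obtain ⟨v, hv⟩ := hr w
    exact ⟨v, (hfw v w).2 hv⟩

/-! ### Correspondences by submersions -/

section Abstract

variable {E : Type*} [NormedAddCommGroup E] [NormedSpace ℝ E] {H : Type*} [TopologicalSpace H]
  {I : ModelWithCorners ℝ E H} {M : Type*} [TopologicalSpace M] [ChartedSpace H M]
  {E' : Type*} [NormedAddCommGroup E'] [NormedSpace ℝ E'] {H' : Type*} [TopologicalSpace H']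
  {I' : ModelWithCorners ℝ E' H'} {M' : Type*} [TopologicalSpace M'] [ChartedSpace H' M']
  {EC : Type*} [NormedAddCommGroup EC] [NormedSpace ℝ EC] {HC : Type*} [TopologicalSpace HC]
  {IC : ModelWithCorners ℝ EC HC} {C : Type*} [TopologicalSpace C] [ChartedSpace HC C]
  [I.Boundaryless] [I'.Boundaryless] [IC.Boundaryless]
  [IsManifold I ∞ M] [IsManifold I' ∞ M'] [IsManifold IC ∞ C]

theorem IsSmoothFormAt.congr_of_eventuallyEq {n : ℕ} {α β : DForm I M n} {x : M}
    (hα : IsSmoothFormAt α x) (h : ∀ᶠ y in 𝓝 x, β y = α y) : IsSmoothFormAt β x := by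
  refine ContDiffAt.congr_of_eventuallyEq hα ?_
  have hc : ContinuousAt (extChartAt I x).symm (extChartAt I x x) := continuousAt_extChartAt_symm x
  rw [← extChartAt_to_inv (I := I) x] at h
  filter_upwards [hc.eventually h] with z hz
  rw [formInChart, formInChart, hz]

variable (I I') in
/-- A map with smooth local sections through every point. -/
def HasLocalSections (f : M → M') : Prop :=
  ∀ x, ∃ s : M' → M, ContMDiffAt I' I ∞ s (f x) ∧ s (f x) = x ∧ ∀ᶠ y in 𝓝 (f x), f (s y) = y

/-- The differential of a local section is a right inverse. -/
theorem HasLocalSections.surjective_mfderiv {f : M → M'} (h : HasLocalSections I I' f)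
    (hf : ContMDiff I I' ∞ f) (x : M) : Function.Surjective (mfderiv I I' f x) := by
  obtain ⟨s, hs, hsx, hfs⟩ := h x
  have key (x' : M) (hx' : s (f x) = x') : Function.Surjective (mfderiv I I' f x') := by
    subst hx'
    intro u
    have hd : MDifferentiableAt I I' f (s (f x)) := (hf _).mdifferentiableAt (by simp)
    have h2 : mfderiv I' I' (f ∘ s) (f x) = mfderiv I' I' id (f x) :=
      Filter.EventuallyEq.mfderiv_eq hfs
    refine ⟨mfderiv I' I s (f x) (u : E'),
      (mfderiv_comp_apply (f x) hd (hs.mdifferentiableAt (by simp)) (u : E')).symm.trans ?_⟩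
    rw [h2, mfderiv_id]
    rfl
  exact key x hsx

/-- Near `f x` the form is recovered by pulling f^*β back along a local section. -/
theorem isSmoothFormAt_of_pullbackForm [FiniteDimensional ℝ E'] {n : ℕ} {f : M → M'}
    (h : HasLocalSections I I' f) (hf : ContMDiff I I' ∞ f) {β : DForm I' M' n} {x : M}
    (hβ : IsSmoothFormAt (pullbackForm I I' f β) x) : IsSmoothFormAt β (f x) := by
  obtain ⟨s, hs, hsx, hfs⟩ := h x
  rw [← hsx] at hβ
  refine (hβ.pullbackForm hs).congr_of_eventuallyEq ?_
  filter_upwards [hfs.eventually_nhds, hs.eventually_mdifferentiableAt] with y hy hd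
  ext v
  have hdf : MDifferentiableAt I I' f (s y) := (hf _).mdifferentiableAt (by simp)
  have h2 : mfderiv I' I' (f ∘ s) y = mfderiv I' I' id y :=
    Filter.EventuallyEq.mfderiv_eq hy
  have h1 (u : E') : (u : E') = mfderiv I I' f (s y) (mfderiv I' I s y u) := by
    refine Eq.trans ?_ (mfderiv_comp_apply y hdf hd u)
    rw [h2, mfderiv_id]
    rfl
  exact DForm.apply_congr β hy.self_of_nhds.symm (funext fun i => h1 (v i))

/-- Near `f x` the field is Y = df ∘ X ∘ s for a local section s. -/
theorem isSmoothFieldAt_of_related {f : M → M'}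
    (h : HasLocalSections I I' f) (hf : ContMDiff I I' ∞ f) {X : ∀ x : M, TangentSpace I x}
    {Y : ∀ x : M', TangentSpace I' x} {x : M} (hX : IsSmoothFieldAt X x)
    (hXY : ∀ x, mfderiv I I' f x (X x) = Y (f x)) : IsSmoothFieldAt Y (f x) := by
  obtain ⟨s, hs, hsx, hfs⟩ := h x
  have : IsManifold I 1 M := .of_le (n := ∞) (by simp)
  have : IsManifold I' 1 M' := .of_le (n := ∞) (by simp)
  have h1 : ContMDiff I.tangent I'.tangent ∞ (tangentMap I I' f) :=
    ContMDiff.contMDiff_tangentMap hf (by simp)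
  rw [← hsx] at hX
  have h2 : ContMDiffAt I' I'.tangent ∞
      (fun y => tangentMap I I' f ⟨s y, X (s y)⟩) (f x) :=
    (h1 _).comp (f x) (ContMDiffAt.comp (f x) hX hs)
  refine h2.congr_of_eventuallyEq ?_
  filter_upwards [hfs] with y hy
  have h3 : tangentMap I I' f ⟨s y, X (s y)⟩ = ⟨f (s y), Y (f (s y))⟩ :=
    congrArg (TotalSpace.mk (f (s y))) (hXY (s y))
  rw [h3, hy]

/-- A 2-form `F` on a correspondence `M ← C → M'` by submersions, pairing the vertical spaces of
the two projections nondegenerately. -/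
structure IsDualPair (p : C → M) (q : C → M') (F : DForm IC C 2) : Prop where
  smooth_left : ContMDiff IC I ∞ p
  smooth_right : ContMDiff IC I' ∞ q
  sections_left : HasLocalSections IC I p
  sections_right : HasLocalSections IC I' q
  surjective_left : Function.Surjective p
  surjective_right : Function.Surjective q
  smooth : ∀ c, IsSmoothFormAt F c
  nondegenerate_left : ∀ (c : C) (Y : TangentSpace IC c), mfderiv IC I' q c Y = 0 →
    (∀ Z, mfderiv IC I p c Z = 0 → F c ![Y, Z] = 0) → Y = 0
  nondegenerate_right : ∀ (c : C) (Z : TangentSpace IC c), mfderiv IC I p c Z = 0 →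
    (∀ Y, mfderiv IC I' q c Y = 0 → F c ![Y, Z] = 0) → Z = 0

variable (I I') in
/-- The T-duality relation at a point of the correspondence. -/
def DualRel (p : C → M) (q : C → M') (F : DForm IC C 2) (c : C)
    (v : E × (E [⋀^Fin 1]→L[ℝ] ℝ)) (w : E' × (E' [⋀^Fin 1]→L[ℝ] ℝ)) : Prop :=
  IsLinearDual (T := EC) (V := E) (W := E') (mfderiv IC I p c : EC →L[ℝ] E)
    (mfderiv IC I' q c : EC →L[ℝ] E') (F c)
    v w

variable {p : C → M} {q : C → M'} {F : DForm IC C 2}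

theorem IsDualPair.isDualTriple (h : IsDualPair (I := I) (I' := I') p q F) (c : C) :
    IsDualTriple (T := EC) (V := E) (W := E') (mfderiv IC I p c : EC →L[ℝ] E)
      (mfderiv IC I' q c : EC →L[ℝ] E')
      (F c) where
  surjective_left := h.sections_left.surjective_mfderiv h.smooth_left c
  surjective_right := h.sections_right.surjective_mfderiv h.smooth_right c
  nondegenerate_left := h.nondegenerate_left c
  nondegenerate_right := h.nondegenerate_right c

/-- Through this symmetry, existence and uniqueness of duals also yield surjectivity and injectivity
of the duality map. -/
theorem IsDualPair.symm (h : IsDualPair (I := I) (I' := I') p q F) :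
    IsDualPair (I := I') (I' := I) q p (-F) where
  smooth_left := h.smooth_right
  smooth_right := h.smooth_left
  sections_left := h.sections_right
  sections_right := h.sections_left
  surjective_left := h.surjective_right
  surjective_right := h.surjective_left
  smooth c := (h.smooth c).neg
  nondegenerate_left c := (h.isDualTriple c).symm.nondegenerate_left
  nondegenerate_right c := (h.isDualTriple c).symm.nondegenerate_right

theorem dualRel_symm_iff {c : C} {v : E × (E [⋀^Fin 1]→L[ℝ] ℝ)}
    {w : E' × (E' [⋀^Fin 1]→L[ℝ] ℝ)} :
    DualRel I' I q p (-F) c w v ↔ DualRel I I' p q F c v w :=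
  isLinearDual_symm_iff

/-- A diffeomorphism of the correspondence covering maps of `M` and `M'` and preserving the
2-form transports the T-duality relation. -/
theorem DualRel.map {g g' : C → C} {a : M → M} {a' : M' → M'}
    (hp : ContMDiff IC I ∞ p) (hq : ContMDiff IC I' ∞ q)
    (hg : ContMDiff IC IC ∞ g) (hg' : ContMDiff IC IC ∞ g') (hgg' : ∀ c, g (g' c) = c)
    (hgg : ∀ c, g' (g c) = c) (ha : ContMDiff I I ∞ a) (ha' : ContMDiff I' I' ∞ a')
    (hpa : ∀ c, p (g c) = a (p c)) (hqa : ∀ c, q (g c) = a' (q c))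
    (hF : pullbackForm IC IC g F = F) {c : C} {v v' : E × (E [⋀^Fin 1]→L[ℝ] ℝ)}
    {w w' : E' × (E' [⋀^Fin 1]→L[ℝ] ℝ)}
    (hv₁ : (mfderiv I I a (p c) v.1 : E) = v'.1)
    (hv₂ : ∀ u : E, v'.2 (fun _ => mfderiv I I a (p c) u) = v.2 (fun _ => u))
    (hw₁ : (mfderiv I' I' a' (q c) w.1 : E') = w'.1)
    (hw₂ : ∀ u : E', w'.2 (fun _ => mfderiv I' I' a' (q c) u) = w.2 (fun _ => u))
    (h : DualRel I I' p q F c v w) : DualRel I I' p q F (g c) v' w' := by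
  have hd : MDifferentiableAt IC IC g c := (hg c).mdifferentiableAt (by simp)
  have hdp (c : C) : MDifferentiableAt IC I p c := (hp c).mdifferentiableAt (by simp)
  have hdq (c : C) : MDifferentiableAt IC I' q c := (hq c).mdifferentiableAt (by simp)
  have hpa' : p ∘ g = a ∘ p := funext hpa
  have hqa' : q ∘ g = a' ∘ q := funext hqa
  refine IsLinearDual.map (T' := EC) (T := EC) (V := E) (W := E') (V' := E) (W' := E')
    (P' := (mfderiv IC I p c : EC →L[ℝ] E))
    (Q' := (mfderiv IC I' q c : EC →L[ℝ] E'))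
    (Ω' := F c) (G := (mfderiv IC IC g c : EC →L[ℝ] EC))
    (A := (mfderiv I I a (p c) : E →L[ℝ] E)) (B := (mfderiv I' I' a' (q c) : E' →L[ℝ] E'))
    ?_ (fun u => ?_) (fun u => ?_) (fun u z => ?_) hv₁ hv₂ hw₁ hw₂ h
  -- The inverse map is a global section of g, so the differential of g is onto.
  · have hs : HasLocalSections IC IC g := fun c => ⟨g', hg' _, hgg c, .of_forall hgg'⟩
    exact hs.surjective_mfderiv hg c
  · refine (mfderiv_comp_apply c (hdp _) hd u).symm.trans ?_
    rw [hpa']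
    exact mfderiv_comp_apply c ((ha _).mdifferentiableAt (by simp)) (hdp c) u
  · refine (mfderiv_comp_apply c (hdq _) hd u).symm.trans ?_
    rw [hqa']
    exact mfderiv_comp_apply c ((ha' _).mdifferentiableAt (by simp)) (hdq c) u
  · have h1 : pullbackForm IC IC g F c ![u, z] = F c ![u, z] := by rw [hF]
    refine Eq.trans ?_ h1
    refine DForm.apply_congr F rfl (funext fun i => ?_)
    fin_cases i <;> rfl

section Sections

variable [FiniteDimensional ℝ E] [FiniteDimensional ℝ E'] [FiniteDimensional ℝ EC]

/-- The lift of a smooth section to the correspondence is smooth. -/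
theorem IsDualPair.isSmoothFieldAt_lift (h : IsDualPair (I := I) (I' := I') p q F)
    {X : ∀ x : M, TangentSpace I x} {ξ : DForm I M 1} (hX : ∀ x, IsSmoothFieldAt X x)
    (hξ : ∀ x, IsSmoothFormAt ξ x) {L : ∀ c : C, TangentSpace IC c}
    (hL : ∀ c, IsLinearLift (T := EC) (V := E) (W := E') (mfderiv IC I p c : EC →L[ℝ] E)
      (mfderiv IC I' q c : EC →L[ℝ] E') (F c) (X (p c), ξ (p c)) (L c)) (c : C) :
    IsSmoothFieldAt L c := by
  have : CompleteSpace E := FiniteDimensional.complete ℝ E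
  have : CompleteSpace EC := FiniteDimensional.complete ℝ EC
  set g := (extChartAt IC c).symm with hg
  set z₀ := extChartAt IC c c with hz₀
  have hgz : g z₀ = c := extChartAt_to_inv c
  let φ := extChartAt I (p c)
  let ψ := extChartAt I' (q c)
  let ph : EC → E := fun z => φ ((p ∘ g) z)
  let qh : EC → E' := fun z => ψ ((q ∘ g) z)
  have hpg : ContMDiffAt 𝓘(ℝ, EC) I ∞ (p ∘ g) z₀ :=
    contMDiffAt_comp_extChartAt_symm (h.smooth_left c)
  have hqg : ContMDiffAt 𝓘(ℝ, EC) I' ∞ (q ∘ g) z₀ :=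
    contMDiffAt_comp_extChartAt_symm (h.smooth_right c)
  have hps : (p ∘ g) z₀ ∈ φ.source := by
    rw [Function.comp_apply, hgz]; exact mem_extChartAt_source _
  have hqs : (q ∘ g) z₀ ∈ ψ.source := by
    rw [Function.comp_apply, hgz]; exact mem_extChartAt_source _
  have hph : ContDiffAt ℝ ∞ ph z₀ := contDiffAt_extChartAt_comp hpg hps
  have hqh : ContDiffAt ℝ ∞ qh z₀ := contDiffAt_extChartAt_comp hqg hqs
  have hphz : ph z₀ = φ (p c) := by simp only [ph, Function.comp_apply, hgz]
  -- In charts of C, M and M' the tangent spaces no longer vary, and the lift becomes the solution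
  -- of a linear system depending on `z`.
  have key : ∀ᶠ z in 𝓝 z₀,
      IsDualTriple (fderiv ℝ ph z) (fderiv ℝ qh z) (modelPullback g F z) ∧
      IsLinearLift (fderiv ℝ ph z) (fderiv ℝ qh z) (modelPullback g F z)
        (fieldInChart X (p c) (ph z), formInChart I ξ (p c) (ph z)) (fieldInChart L c z) := by
    filter_upwards [extChartAt_target_mem_nhds (I := IC) c,
      hpg.continuousAt.preimage_mem_nhds ((isOpen_extChartAt_source _).mem_nhds hps),
      hqg.continuousAt.preimage_mem_nhds ((isOpen_extChartAt_source _).mem_nhds hqs)]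
      with z hz hzp hzq
    have hdg : MDifferentiableAt 𝓘(ℝ, EC) IC g z :=
      (contMDiffAt_extChartAt_symm hz).mdifferentiableAt (by simp)
    have hdp : MDifferentiableAt IC I p (g z) := (h.smooth_left _).mdifferentiableAt (by simp)
    have hdq : MDifferentiableAt IC I' q (g z) := (h.smooth_right _).mdifferentiableAt (by simp)
    let G : EC →L[ℝ] EC := mfderiv 𝓘(ℝ, EC) IC g z
    let A : E →L[ℝ] E := mfderiv I 𝓘(ℝ, E) φ (p (g z))
    let B : E' →L[ℝ] E' := mfderiv I' 𝓘(ℝ, E') ψ (q (g z))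
    let P : EC →L[ℝ] E := mfderiv IC I p (g z)
    let Q : EC →L[ℝ] E' := mfderiv IC I' q (g z)
    have hG : Function.Bijective G := (isInvertible_mfderiv_extChartAt_symm hz).bijective
    have : IsManifold I 1 M := .of_le (n := ∞) (by simp)
    have : IsManifold I' 1 M' := .of_le (n := ∞) (by simp)
    have hA : Function.Bijective A := (isInvertible_mfderiv_extChartAt hzp).bijective
    have hB : Function.Bijective B := (isInvertible_mfderiv_extChartAt hzq).bijective
    have hPG (u : EC) : fderiv ℝ ph z u = A (P (G u)) :=
      (fderiv_extChartAt_comp (hdp.comp z hdg) hzp u).trans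
        (congrArg A (mfderiv_comp_apply z hdp hdg u))
    have hQG (u : EC) : fderiv ℝ qh z u = B (Q (G u)) :=
      (fderiv_extChartAt_comp (hdq.comp z hdg) hzq u).trans
        (congrArg B (mfderiv_comp_apply z hdq hdg u))
    have hΩ (u w : EC) : modelPullback g F z ![u, w] = F (g z) ![G u, G w] := by
      rw [modelPullback_apply]
      refine DForm.apply_congr F rfl (funext fun i => ?_)
      fin_cases i <;> rfl
    refine ⟨(h.isDualTriple (g z)).comap hG hA hB hPG hQG hΩ,
      IsLinearLift.comap (A := A) (B := B) (G := G) (P := P) (Q := Q) (Ω := F (g z)) hB.1 hPG hQG hΩ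
        (v := (X (p (g z)), ξ (p (g z)))) ?_ (fun u => ?_) ?_⟩
    · exact fieldInChart_extChartAt X hzp
    · rw [formInChart_eq_modelPullback]
      refine (modelPullback_apply _ _ _ _).trans ?_
      exact DForm.apply_congr ξ (φ.left_inv hzp)
        (funext fun i => mfderiv_extChartAt_symm_comp hzp u)
    · have h1 : G (fieldInChart L c z) = L (g z) := mfderiv_extChartAt_symm_fieldInChart L hz
      rw [h1]
      exact hL (g z)
  have hsys : ContDiffAt ℝ ∞
      (fun z => dualitySystem (fderiv ℝ ph z) (fderiv ℝ qh z) (modelPullback g F z)) z₀ := by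
    refine ContDiffAt.dualitySystem (hph.fderiv_right le_rfl) (hqh.fderiv_right le_rfl) ?_
    exact contDiffAt_modelPullback (h.smooth _)
      (contMDiffAt_extChartAt_symm (mem_extChartAt_target c))
  have hfield : ContDiffAt ℝ ∞ (fun z => fieldInChart X (p c) (ph z)) z₀ := by
    refine ContDiffAt.comp (g := fieldInChart X (p c)) z₀ ?_ hph
    rw [hphz]
    exact (hX (p c)).contDiffAt_fieldInChart_self
  have hform : ContDiffAt ℝ ∞ (fun z => formInChart I ξ (p c) (ph z)) z₀ := by
    refine ContDiffAt.comp (g := formInChart I ξ (p c)) z₀ ?_ hph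
    rw [hphz]
    exact hξ (p c)
  -- Inversion is smooth at an invertible operator, so invertibility at the centre suffices here.
  have hinv := (key.self_of_nhds.1.isInvertible).contDiffAt_map_inverse (n := ∞) |>.comp z₀ hsys
  have hdual : ContDiffAt ℝ ∞ (fun z => oneFormToDual (formInChart I ξ (p c) (ph z))) z₀ :=
    contDiffAt_const.clm_apply hform
  have hsol := (hinv.clm_apply (hfield.prodMk (hdual.clm_comp (hph.fderiv_right le_rfl)))).fst
  refine isSmoothFieldAt_of_chart (V := fieldInChart L c) (hsol.congr_of_eventuallyEq ?_) ?_
  · filter_upwards [key] with z hz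
    exact hz.2.eq_inverse hz.1
  · filter_upwards [extChartAt_target_mem_nhds (I := IC) c] with z hz
    exact mfderiv_extChartAt_symm_fieldInChart L hz

end Sections

end Abstract

/-! ### Duality of sections and their brackets -/

section DualSections

variable {E : Type*} [NormedAddCommGroup E] [NormedSpace ℝ E] {H : Type*} [TopologicalSpace H]
  {I : ModelWithCorners ℝ E H} {M : Type*} [TopologicalSpace M] [ChartedSpace H M]
  {E' : Type*} [NormedAddCommGroup E'] [NormedSpace ℝ E'] {H' : Type*} [TopologicalSpace H']
  {I' : ModelWithCorners ℝ E' H'} {M' : Type*} [TopologicalSpace M'] [ChartedSpace H' M']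
  {EC : Type*} [NormedAddCommGroup EC] [NormedSpace ℝ EC] {HC : Type*} [TopologicalSpace HC]
  {IC : ModelWithCorners ℝ EC HC} {C : Type*} [TopologicalSpace C] [ChartedSpace HC C]
  [I.Boundaryless] [I'.Boundaryless] [IC.Boundaryless]
  [IsManifold I ∞ M] [IsManifold I' ∞ M'] [IsManifold IC ∞ C]
  [FiniteDimensional ℝ E] [FiniteDimensional ℝ E'] [FiniteDimensional ℝ EC]
  {p : C → M} {q : C → M'} {F : DForm IC C 2}

/-- Smoothness of a section of `TM ⊕ T*M`. -/
def IsSmoothSection (v : GenSection I M) : Prop :=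
  (∀ x, IsSmoothFieldAt (fun y => (v y).1) x) ∧ ∀ x, IsSmoothFormAt (fun y => (v y).2) x

theorem IsSmoothSection.courantBracket {h : DForm I M 3} (hh : ∀ x, IsSmoothFormAt h x)
    {v w : GenSection I M} (hv : IsSmoothSection v) (hw : IsSmoothSection w) :
    IsSmoothSection (courantBracket I h v w) := by
  have : CompleteSpace E := FiniteDimensional.complete ℝ E
  exact ⟨fun x => (hv.1 x).mlieBracket (hw.1 x),
    IsSmoothFormAt.courantForm hh hv.1 hw.1 hv.2 hw.2⟩

/-- The sections `v` and `w` are T-dual over every point of the correspondence. -/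
def DualSections (p : C → M) (q : C → M') (F : DForm IC C 2) (v : GenSection I M)
    (w : GenSection I' M') : Prop :=
  ∀ c, DualRel I I' p q F c (v (p c)) (w (q c))

theorem dualSections_symm_iff {v : GenSection I M} {w : GenSection I' M'} :
    DualSections q p (-F) w v ↔ DualSections p q F v w :=
  forall_congr' fun _ => dualRel_symm_iff

/-- Collects the pointwise witnesses into one smooth field on the correspondence, so that the
duality relation becomes an identity of differential forms that can be differentiated. -/
theorem IsDualPair.exists_lift (h : IsDualPair (I := I) (I' := I') p q F) {v : GenSection I M}
    {w : GenSection I' M'} (hv : IsSmoothSection v) (hvw : DualSections p q F v w) :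
    ∃ L : ∀ c : C, TangentSpace IC c, (∀ c, IsSmoothFieldAt L c) ∧
      (∀ c, mfderiv IC I p c (L c) = (v (p c)).1) ∧
      (∀ c, mfderiv IC I' q c (L c) = (w (q c)).1) ∧
      pullbackForm IC I' q (fun x => (w x).2) =
        pullbackForm IC I p (fun x => (v x).2) - contract IC L F := by
  choose L hL hw₁ hw₂ using fun c => (hvw c).exists_lift
  refine ⟨L, h.isSmoothFieldAt_lift hv.1 hv.2 hL, fun c => (hL c).1, fun c => (hw₁ c).symm, ?_⟩
  funext c
  refine ContinuousAlternatingMap.ext_one (W := EC) fun u => ?_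
  refine (hw₂ c u).trans ?_
  have e : F c ![L c, u] = contract IC L F c (fun _ => u) := by
    refine DForm.apply_congr F rfl (funext fun i => ?_)
    fin_cases i <;> rfl
  exact congrArg _ e

/-- On the correspondence both parts are smooth: the vector part lifts to L and the covector part
pulls back to a smooth form. Local sections of q carry this down. -/
theorem IsDualPair.isSmoothSection (h : IsDualPair (I := I) (I' := I') p q F)
    {v : GenSection I M} {w : GenSection I' M'} (hv : IsSmoothSection v)
    (hvw : DualSections p q F v w) : IsSmoothSection w := by
  have : CompleteSpace EC := FiniteDimensional.complete ℝ EC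
  obtain ⟨L, hL, -, hq, hw⟩ := h.exists_lift hv hvw
  constructor
  · intro x
    obtain ⟨c, rfl⟩ := h.surjective_right x
    exact isSmoothFieldAt_of_related h.sections_right h.smooth_right (hL c) hq
  · intro x
    obtain ⟨c, rfl⟩ := h.surjective_right x
    refine isSmoothFormAt_of_pullbackForm h.sections_right h.smooth_right ?_
    rw [hw]
    exact ((hv.2 _).pullbackForm (h.smooth_left c)).sub ((h.smooth c).contract (hL c))

/-- Twisted Courant brackets of T-dual sections are T-dual. -/
theorem DualSections.courantBracket (h : IsDualPair (I := I) (I' := I') p q F)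
    {η : DForm I M 3} {η' : DForm I' M' 3}
    (hη : pullbackForm IC I p η - pullbackForm IC I' q η' = mextDeriv IC F)
    {v₁ v₂ : GenSection I M} {w₁ w₂ : GenSection I' M'} (hv₁ : IsSmoothSection v₁)
    (hv₂ : IsSmoothSection v₂) (h₁ : DualSections p q F v₁ w₁) (h₂ : DualSections p q F v₂ w₂) :
    DualSections p q F (courantBracket I η v₁ v₂) (courantBracket I' η' w₁ w₂) := by
  have : CompleteSpace E := FiniteDimensional.complete ℝ E
  have : CompleteSpace E' := FiniteDimensional.complete ℝ E'
  have : CompleteSpace EC := FiniteDimensional.complete ℝ EC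
  have hw₁ := h.isSmoothSection hv₁ h₁
  have hw₂ := h.isSmoothSection hv₂ h₂
  obtain ⟨X, hX, hXp, hXq, hXw⟩ := h.exists_lift hv₁ h₁
  obtain ⟨Y, hY, hYp, hYq, hYw⟩ := h.exists_lift hv₂ h₂
  have hη' : pullbackForm IC I' q η' = pullbackForm IC I p η - mextDeriv IC F := by
    rw [← hη, sub_sub_cancel]
  have key : pullbackForm IC I' q (courantForm I' η' (fun y => (w₁ y).1) (fun y => (w₂ y).1)
        (fun y => (w₁ y).2) (fun y => (w₂ y).2)) =
      pullbackForm IC I p (courantForm I η (fun y => (v₁ y).1) (fun y => (v₂ y).1)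
        (fun y => (v₁ y).2) (fun y => (v₂ y).2)) -
        contract IC (VectorField.mlieBracket IC X Y) F := by
    -- Upstairs, the data pulled back by q are the B-field transform of those pulled back by p, with
    -- flux shifted by dF.
    rw [pullbackForm_courantForm h.smooth_right hw₁.1 hw₁.2 hw₂.2 hXq hYq, hη', hXw, hYw,
      courantForm_sub_contract h.smooth hX hY
        (fun c => (hv₁.2 _).pullbackForm (h.smooth_left c))
        (fun c => (hv₂.2 _).pullbackForm (h.smooth_left c)),
      pullbackForm_courantForm h.smooth_left hv₁.1 hv₁.2 hv₂.2 hXp hYp]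
  intro c
  -- The bracket of the two lifts is the witness. Its projections come from relatedness and its
  -- covector equation from `key`; that it is a basic lift need not be checked.
  refine ⟨(VectorField.mlieBracket IC X Y c : EC), ?_, ?_, fun Z => ?_⟩
  · exact mfderiv_mlieBracket_of_related (h.smooth_left c) (hX c) (hY c) (hv₁.1 _) (hv₂.1 _)
      (.of_forall hXp) (.of_forall hYp)
  · exact mfderiv_mlieBracket_of_related (h.smooth_right c) (hX c) (hY c) (hw₁.1 _) (hw₂.1 _)
      (.of_forall hXq) (.of_forall hYq)
  · refine (congrArg (fun α : DForm IC C 1 => α c (fun _ => (Z : EC))) key).trans ?_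
    have e : contract IC (VectorField.mlieBracket IC X Y) F c (fun _ => (Z : EC)) =
        F c ![VectorField.mlieBracket IC X Y c, Z] := by
      refine DForm.apply_congr F rfl (funext fun i => ?_)
      fin_cases i <;> rfl
    let r : ℝ := (courantForm I η (fun y => (v₁ y).1) (fun y => (v₂ y).1)
      (fun y => (v₁ y).2) (fun y => (v₂ y).2)) (p c) (fun _ => mfderiv IC I p c (Z : EC))
    exact congrArg (fun y => r - y) e

theorem IsDualPair.dualSections_unique (h : IsDualPair (I := I) (I' := I') p q F)
    {v : GenSection I M} {w w' : GenSection I' M'} (hw : DualSections p q F v w)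
    (hw' : DualSections p q F v w') : w = w' := by
  funext x
  obtain ⟨c, rfl⟩ := h.surjective_right x
  exact (hw c).unique (h.isDualTriple c) (hw' c)

/-- A section whose pointwise duals agree along the fibres of `q` has a dual section. -/
theorem IsDualPair.exists_dualSections (h : IsDualPair (I := I) (I' := I') p q F)
    {v : GenSection I M} (hv : ∀ c c' (w : E' × (E' [⋀^Fin 1]→L[ℝ] ℝ)), q c = q c' →
      DualRel I I' p q F c (v (p c)) w → DualRel I I' p q F c' (v (p c')) w) :
    ∃ w : GenSection I' M', DualSections p q F v w := by
  -- An arbitrary set-theoretic choice of points over M' is enough; by `hv` the result is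
  -- independent of it.
  choose s hs using h.surjective_right
  choose w hw using fun x => (h.isDualTriple (s x)).exists_dual (v (p (s x)))
  exact ⟨w, fun c => hv (s (q c)) c _ (hs _) (hw (q c))⟩

/-- The Courant bracket of invariant sections is invariant. -/
theorem courantBracket_invariant {f : M → M} (hf : ContMDiff I I ∞ f) {η : DForm I M 3}
    (hη : pullbackForm I I f η = η) {v w : GenSection I M}
    (hv : IsSmoothSection v) (hw : IsSmoothSection w)
    (hv₁ : ∀ x, mfderiv I I f x (v x).1 = (v (f x)).1)
    (hw₁ : ∀ x, mfderiv I I f x (w x).1 = (w (f x)).1)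
    (hv₂ : pullbackForm I I f (fun x => (v x).2) = fun x => (v x).2)
    (hw₂ : pullbackForm I I f (fun x => (w x).2) = fun x => (w x).2) :
    (∀ x, mfderiv I I f x (courantBracket I η v w x).1 = (courantBracket I η v w (f x)).1) ∧
      pullbackForm I I f (fun x => (courantBracket I η v w x).2) =
        fun x => (courantBracket I η v w x).2 := by
  have : CompleteSpace E := FiniteDimensional.complete ℝ E
  refine ⟨fun x => mfderiv_mlieBracket_of_related (hf x) (hv.1 x) (hw.1 x) (hv.1 _) (hw.1 _)
    (.of_forall hv₁) (.of_forall hw₁), ?_⟩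
  rw [courantBracket_snd, pullbackForm_courantForm hf hv.1 hv.2 hw.2 hv₁ hw₁, hη, hv₂, hw₂]

/-- The dual of an invariant section is invariant. -/
theorem DualSections.invariant (h : IsDualPair (I := I) (I' := I') p q F)
    {g g' : C → C} {a : M → M} {a' a'' : M' → M'}
    (hg : ContMDiff IC IC ∞ g) (hg' : ContMDiff IC IC ∞ g') (hgg' : ∀ c, g (g' c) = c)
    (hgg : ∀ c, g' (g c) = c) (ha : ContMDiff I I ∞ a) (ha' : ContMDiff I' I' ∞ a')
    (ha'' : ContMDiff I' I' ∞ a'') (haa : ∀ x, a'' (a' x) = x)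
    (hpa : ∀ c, p (g c) = a (p c)) (hqa : ∀ c, q (g c) = a' (q c))
    (hF : pullbackForm IC IC g F = F) {v : GenSection I M} {w : GenSection I' M'}
    (hvw : DualSections p q F v w)
    (hv₁ : ∀ x, mfderiv I I a x (v x).1 = (v (a x)).1)
    (hv₂ : pullbackForm I I a (fun x => (v x).2) = fun x => (v x).2) :
    (∀ x, mfderiv I' I' a' x (w x).1 = (w (a' x)).1) ∧
      pullbackForm I' I' a' (fun x => (w x).2) = fun x => (w x).2 := by
  have key (x : M') (u : E') :
      (mfderiv I' I' a'' (a' x) (mfderiv I' I' a' x u) : E') = u := by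
    refine (mfderiv_comp_apply x ((ha'' _).mdifferentiableAt (by simp))
      ((ha' x).mdifferentiableAt (by simp)) u).symm.trans ?_
    have e : a'' ∘ a' = id := funext haa
    rw [e, mfderiv_id]
    rfl
  -- The transported value of w, with its covector pulled back along the inverse `a''`, is dual to v
  -- at `a (p c)`. So is w at `a' (q c)`, and duals are unique.
  have main (c : C) : ((mfderiv I' I' a' (q c) (w (q c)).1 : E'),
      ContinuousAlternatingMap.compContinuousLinearMap ((w (q c)).2 : E' [⋀^Fin 1]→L[ℝ] ℝ)
        (mfderiv I' I' a'' (a' (q c)) : E' →L[ℝ] E')) =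
      (w (a' (q c)) : E' × (E' [⋀^Fin 1]→L[ℝ] ℝ)) := by
    have hvc (y : M) (hy : y = a (p c)) : (v y : E × (E [⋀^Fin 1]→L[ℝ] ℝ)) = v (a (p c)) := by
      rw [hy]
    have hwc (y : M') (hy : y = a' (q c)) :
        (w y : E' × (E' [⋀^Fin 1]→L[ℝ] ℝ)) = w (a' (q c)) := by
      rw [hy]
    have h2 : DualRel I I' p q F (g c) (v (a (p c))) (w (a' (q c))) := by
      rw [← hvc _ (hpa c), ← hwc _ (hqa c)]
      exact hvw (g c)
    refine IsLinearDual.unique (h.isDualTriple (g c)) ?_ h2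
    refine DualRel.map h.smooth_left h.smooth_right hg hg' hgg' hgg ha ha' hpa hqa hF
      (hv₁ (p c)) (fun u => ?_) rfl (fun u => ?_) (hvw c)
    · exact congrArg (fun α : DForm I M 1 => α (p c) (fun _ => u)) hv₂
    · exact congrArg (fun u : E' => (w (q c)).2 (fun _ => u)) (key (q c) u)
  constructor
  · intro x
    obtain ⟨c, rfl⟩ := h.surjective_right x
    exact congrArg Prod.fst (main c)
  · funext x
    obtain ⟨c, rfl⟩ := h.surjective_right x
    refine ContinuousAlternatingMap.ext_one (W := E') fun u => ?_
    have e := congrArg (fun y => y.2 (fun _ => (mfderiv I' I' a' (q c) u : E'))) (main c)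
    refine Eq.trans e.symm ?_
    exact congrArg (fun u : E' => (w (q c)).2 (fun _ => u)) (key (q c) u)

theorem mem_invariantSections_iff {G : Type*} [SMul G M] {v : GenSection I M} :
    v ∈ invariantSections I G M ↔ IsSmoothSection v ∧ ∀ t : G,
      (∀ x, mfderiv I I (fun m : M => t • m) x (v x).1 = (v (t • x)).1) ∧
      pullbackForm I I (fun m : M => t • m) (fun x => (v x).2) = fun x => (v x).2 := by
  constructor
  · rintro ⟨h1, h2, h3, h4⟩
    exact ⟨⟨h1, isSmoothForm_iff.1 h2⟩, fun t => ⟨h3 t, h4 t⟩⟩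
  · rintro ⟨⟨h1, h2⟩, h3⟩
    exact ⟨h1, isSmoothForm_iff.2 h2, fun t => (h3 t).1, fun t => (h3 t).2⟩

theorem IsSmoothSection.smul {f : M → ℝ} (hf : ContMDiff I 𝓘(ℝ, ℝ) ∞ f) {v : GenSection I M}
    (hv : IsSmoothSection v) : IsSmoothSection (fun x => f x • v x) := by
  refine ⟨fun x => ContMDiffAt.smul_section (hf x) (hv.1 x), fun x => ?_⟩
  have h := contMDiffAt_iff_contDiffAt.1 (contMDiffAt_comp_extChartAt_symm (hf x))
  exact ContDiffAt.smul h (hv.2 x)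

theorem smul_mem_invariantSections {G : Type*} [SMul G M] {f : M → ℝ}
    (hf : ContMDiff I 𝓘(ℝ, ℝ) ∞ f) (hfG : ∀ (t : G) x, f (t • x) = f x) {v : GenSection I M}
    (hv : v ∈ invariantSections I G M) : (fun x => f x • v x) ∈ invariantSections I G M := by
  rw [mem_invariantSections_iff] at *
  refine ⟨hv.1.smul hf, fun t => ⟨fun x => ?_, ?_⟩⟩
  · have h1 := congrArg (fun u : E => f x • u) ((hv.2 t).1 x)
    refine Eq.trans (ContinuousLinearMap.map_smul _ _ _) (h1.trans ?_)
    rw [← hfG t x]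
    rfl
  · funext x
    have h1 := congrArg (fun α : DForm I M 1 => f x • α x) (hv.2 t).2
    refine Eq.trans ?_ h1
    rw [← hfG t x]
    rfl

theorem DualSections.smul {f : M → ℝ} {f' : M' → ℝ} (hf : ∀ c, f (p c) = f' (q c))
    {v : GenSection I M} {w : GenSection I' M'} (hvw : DualSections p q F v w) :
    DualSections p q F (fun x => f x • v x) (fun x => f' x • w x) := by
  intro c
  have key (r : ℝ) (hr : f (p c) = r) : DualRel I I' p q F c (f (p c) • v (p c)) (r • w (q c)) := by
    subst hr
    exact IsLinearDual.smul (f (p c)) (hvw c)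
  exact key _ (hf c)

/-- Invariant sections have invariant duals if the fibres of `q` are orbits of symmetries of the
correspondence that cover the action on `M` and the identity of `M'`. -/
theorem IsDualPair.exists_invariant_dual {G : Type*} [Group G] [MulAction G M] [MulAction G M']
    (h : IsDualPair (I := I) (I' := I') p q F) {act : G → G → C → C}
    (hact : ∀ s t, ContMDiff IC IC ∞ (act s t)) (hmul : ∀ s t c, act s t (act s⁻¹ t⁻¹ c) = c)
    (hsmul : ∀ s : G, ContMDiff I I ∞ (fun x : M => s • x))
    (hsmul' : ∀ t : G, ContMDiff I' I' ∞ (fun x : M' => t • x))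
    (hp : ∀ s t c, p (act s t c) = s • p c) (hq : ∀ s t c, q (act s t c) = t • q c)
    (hF : ∀ s t, pullbackForm IC IC (act s t) F = F)
    (hfib : ∀ c c', q c = q c' → ∃ s, act s 1 c = c')
    {v : GenSection I M} (hv : v ∈ invariantSections I G M) :
    ∃ w ∈ invariantSections I' G M', DualSections p q F v w := by
  rw [mem_invariantSections_iff] at hv
  have hmul' (s t : G) (c : C) : act s⁻¹ t⁻¹ (act s t c) = c := by
    simpa using hmul s⁻¹ t⁻¹ c
  obtain ⟨w, hw⟩ := h.exists_dualSections (v := v) fun c c' w hcc' hc => by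
    obtain ⟨s, rfl⟩ := hfib c c' hcc'
    have e : (fun x : M' => (1 : G) • x) = id := funext (one_smul G)
    have e' (u : E') : (mfderiv I' I' (fun x : M' => (1 : G) • x) (q c) u : E') = u := by
      rw [e, mfderiv_id]
      rfl
    have hvc (y : M) (hy : y = s • p c) : (v y : E × (E [⋀^Fin 1]→L[ℝ] ℝ)) = v (s • p c) := by
      rw [hy]
    rw [hvc _ (hp s 1 c)]
    -- The symmetry (s, 1) leaves w unchanged, since 1 acts on M' with identity differential, and
    -- moves v to its value at s • p c by invariance.
    refine DualRel.map h.smooth_left h.smooth_right (hact s 1) (hact s⁻¹ 1⁻¹) (hmul s 1)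
      (hmul' s 1) (hsmul s) (hsmul' 1) (hp s 1) (hq s 1) (hF s 1)
      ((hv.2 s).1 (p c)) (fun u => ?_) (e' _) (fun u => ?_) hc
    · exact congrArg (fun α : DForm I M 1 => α (p c) (fun _ => u)) (hv.2 s).2
    · exact congrArg (fun u : E' => w.2 (fun _ => u)) (e' u)
  refine ⟨w, mem_invariantSections_iff.2 ⟨h.isSmoothSection hv.1 hw, fun t => ?_⟩, hw⟩
  -- Invariance under t on M' is tested with the diagonal symmetry (t, t), which covers t on both
  -- sides.
  exact DualSections.invariant h (hact t t) (hact t⁻¹ t⁻¹) (hmul t t) (hmul' t t) (hsmul t)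
    (hsmul' t) (hsmul' t⁻¹) (inv_smul_smul t) (hp t t) (hq t t) (hF t t) hw (hv.2 t).1 (hv.2 t).2

end DualSections

/-- Supplies the absence of boundary for the torus model, and hence for the correspondence space. -/
instance ModelWithCorners.boundaryless_pi {ι : Type*} [Fintype ι] {E : ι → Type*}
    [∀ i, NormedAddCommGroup (E i)] [∀ i, NormedSpace ℝ (E i)] {H : ι → Type*}
    [∀ i, TopologicalSpace (H i)] (I : ∀ i, ModelWithCorners ℝ (E i) (H i))
    [∀ i, (I i).Boundaryless] : (ModelWithCorners.pi I).Boundaryless where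
  range_eq_univ := by
    refine eq_univ_of_forall fun x => ?_
    have h (i : ι) : ∃ y, I i y = x i := by
      have : x i ∈ range (I i) := by rw [(I i).range_eq_univ]; trivial
      exact this
    choose y hy using h
    exact ⟨y, funext hy⟩

/-! ### The correspondence space of two torus bundles -/

namespace TDuality

section TorusBundles

variable {k : ℕ}
  {EB : Type*} [NormedAddCommGroup EB] [NormedSpace ℝ EB]
  {EM : Type*} [NormedAddCommGroup EM] [NormedSpace ℝ EM]
  {EM' : Type*} [NormedAddCommGroup EM'] [NormedSpace ℝ EM']
  {B : Type*} [TopologicalSpace B] [ChartedSpace EB B]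
  {M : Type*} [TopologicalSpace M] [ChartedSpace EM M] [MulAction (Torus k) M]
  {M' : Type*} [TopologicalSpace M'] [ChartedSpace EM' M'] [MulAction (Torus k) M']

/-- In an equivariant trivialization the required group element is the quotient of the two fibre
coordinates. -/
theorem PrincipalTorusBundle.exists_smul_eq (P : PrincipalTorusBundle k EB EM B M) {m m' : M}
    (h : P.proj m = P.proj m') : ∃ t : Torus k, t • m = m' := by
  obtain ⟨e, hb, -, -, he⟩ := P.exists_trivialization (P.proj m)
  have hm : m ∈ e.source := e.mem_source.2 hb
  have hm' : m' ∈ e.source := e.mem_source.2 (h ▸ hb)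
  refine ⟨(e m').2 * (e m).2⁻¹, e.injOn (e.mem_source.2 (by rwa [P.proj_smul])) hm' ?_⟩
  change e _ = e m'
  rw [he _ m hm, inv_mul_cancel_right, e.coe_fst hm, h, ← e.coe_fst hm']

theorem PrincipalTorusBundle.contMDiff_const_smul (P : PrincipalTorusBundle k EB EM B M)
    (t : Torus k) : ContMDiff 𝓘(ℝ, EM) 𝓘(ℝ, EM) ∞ (fun m : M => t • m) :=
  P.contMDiff_smul.comp (contMDiff_const.prodMk contMDiff_id)

namespace Correspondence

variable {P : PrincipalTorusBundle k EB EM B M} {Q : PrincipalTorusBundle k EB EM' B M'}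

theorem fst_surjective : Function.Surjective (fst : Correspondence P Q → M) := fun m => by
  obtain ⟨m', hm'⟩ := Q.surjective (P.proj m)
  exact ⟨⟨m, m', hm'.symm⟩, rfl⟩

theorem snd_surjective : Function.Surjective (snd : Correspondence P Q → M') := fun m' => by
  obtain ⟨m, hm⟩ := P.surjective (Q.proj m')
  exact ⟨⟨m, m', hm⟩, rfl⟩

theorem exists_smul_eq_of_snd_eq {c c' : Correspondence P Q} (h : c.snd = c'.snd) :
    ∃ t : Torus k, (t, (1 : Torus k)) • c = c' := by
  obtain ⟨t, ht⟩ := P.exists_smul_eq (m := c.fst) (m' := c'.fst) (by rw [c.comm, c'.comm, h])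
  exact ⟨t, Correspondence.ext ht ((one_smul _ _).trans h)⟩

theorem exists_smul_eq_of_fst_eq {c c' : Correspondence P Q} (h : c.fst = c'.fst) :
    ∃ t : Torus k, ((1 : Torus k), t) • c = c' := by
  obtain ⟨t, ht⟩ := Q.exists_smul_eq (m := c.snd) (m' := c'.snd) (by rw [← c.comm, ← c'.comm, h])
  exact ⟨t, Correspondence.ext ((one_smul _ _).trans h) ht⟩

variable [IsManifold 𝓘(ℝ, EM) ∞ M]

theorem contMDiff_const_smul (t : Torus k × Torus k) :
    ContMDiff (corrModel k EM) (corrModel k EM) ∞ (fun c : Correspondence P Q => t • c) :=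
  contMDiff_of_components ((P.contMDiff_const_smul t.1).comp contMDiff_fst)
    ((Q.contMDiff_const_smul t.2).comp contMDiff_snd)

/-- A section through c keeps the fibre coordinate of `c.snd` constant in a trivialization of M'. -/
theorem hasLocalSections_fst :
    HasLocalSections (corrModel k EM) 𝓘(ℝ, EM) (fst : Correspondence P Q → M) := by
  intro c
  obtain ⟨e, hb, he⟩ := Q.exists_trivialization (Q.proj c.snd)
  have hc : c ∈ (localTriv P e).source := hb
  refine ⟨fun m => (localTriv P e).symm (m, (e c.snd).2), ?_, (localTriv P e).left_inv hc,
    .of_forall fun _ => rfl⟩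
  have h1 : ContMDiffAt (corrModel k EM) (corrModel k EM) ∞ (localTriv P e).symm
      (c.fst, (e c.snd).2) :=
    (contMDiffOn_localTriv_symm he).contMDiffAt
      ((localTriv P e).open_target.mem_nhds ((localTriv P e).map_source hc))
  exact h1.comp c.fst (contMDiffAt_id.prodMk contMDiffAt_const)

/-- The charts of the correspondence space are modelled on M × T^k, so this case is less direct. A
trivialization d of M supplies a point over the base with constant fibre coordinate, while e records
the coordinate of the given point of M'. -/
theorem hasLocalSections_snd :
    HasLocalSections (corrModel k EM) 𝓘(ℝ, EM') (snd : Correspondence P Q → M') := by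
  intro c
  obtain ⟨e, hb, he⟩ := Q.exists_trivialization (Q.proj c.snd)
  obtain ⟨d, hd, hd'⟩ := P.exists_trivialization (P.proj c.fst)
  have hc : c ∈ (localTriv P e).source := hb
  have hdb : Q.proj c.snd ∈ d.baseSet := c.comm ▸ hd
  have h0 : d.toOpenPartialHomeomorph.symm (Q.proj c.snd, (d c.fst).2) = c.fst := by
    rw [← c.comm]
    exact d.symm_apply_mk_proj (d.mem_source.2 hd)
  refine ⟨fun m => (localTriv P e).symm
    (d.toOpenPartialHomeomorph.symm (Q.proj m, (d c.fst).2), (e m).2), ?_, ?_, ?_⟩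
  · have h1 : ContMDiffAt (corrModel k EM) (corrModel k EM) ∞ (localTriv P e).symm
        (d.toOpenPartialHomeomorph.symm (Q.proj c.snd, (d c.fst).2), (e c.snd).2) := by
      rw [h0]
      exact (contMDiffOn_localTriv_symm he).contMDiffAt
        ((localTriv P e).open_target.mem_nhds ((localTriv P e).map_source hc))
    have h2 : ContMDiffAt (𝓘(ℝ, EB).prod (torusModel k)) 𝓘(ℝ, EM) ∞
        d.toOpenPartialHomeomorph.symm (Q.proj c.snd, (d c.fst).2) :=
      hd'.2.1.contMDiffAt (d.open_target.mem_nhds (d.mem_target.2 hdb))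
    have h3 : ContMDiffAt 𝓘(ℝ, EM') 𝓘(ℝ, EM) ∞
        (fun m => d.toOpenPartialHomeomorph.symm (Q.proj m, (d c.fst).2)) c.snd :=
      h2.comp c.snd ((Q.contMDiff_proj c.snd).prodMk contMDiffAt_const)
    have h4 : ContMDiffAt 𝓘(ℝ, EM') (torusModel k) ∞ (fun m => (e m).2) c.snd :=
      contMDiffAt_snd.comp c.snd (he.1.contMDiffAt (e.open_source.mem_nhds (e.mem_source.2 hb)))
    exact h1.comp c.snd (h3.prodMk h4)
  · dsimp only
    rw [h0]
    exact (localTriv P e).left_inv hc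
  · have hU := (Q.contMDiff_proj.continuous.continuousAt (x := c.snd)).preimage_mem_nhds
      ((d.open_baseSet.inter e.open_baseSet).mem_nhds ⟨hdb, hb⟩)
    filter_upwards [hU] with m hm
    change pointOver e (P.proj _) (e m).2 = m
    rw [d.proj_symm_apply' hm.1, pointOver_of_mem e hm.2]
    exact e.symm_apply_mk_proj (e.mem_source.2 hm.2)

end Correspondence

variable {P : PrincipalTorusBundle k EB EM B M} {Q : PrincipalTorusBundle k EB EM' B M'}
  [IsManifold 𝓘(ℝ, EM) ∞ M] [IsManifold 𝓘(ℝ, EM') ∞ M']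
  [FiniteDimensional ℝ EM] [FiniteDimensional ℝ EM']
  {h : DForm 𝓘(ℝ, EM) M 3} {h' : DForm 𝓘(ℝ, EM') M' 3}
  {F : DForm (corrModel k EM) (Correspondence P Q) 2}

theorem IsTDuality.isDualPair (hF : IsTDuality h h' F) :
    IsDualPair (I := 𝓘(ℝ, EM)) (I' := 𝓘(ℝ, EM')) (Correspondence.fst : Correspondence P Q → M)
      (Correspondence.snd : Correspondence P Q → M') F where
  smooth_left := Correspondence.contMDiff_fst
  smooth_right := Correspondence.contMDiff_snd
  sections_left := Correspondence.hasLocalSections_fst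
  sections_right := Correspondence.hasLocalSections_snd
  surjective_left := Correspondence.fst_surjective
  surjective_right := Correspondence.snd_surjective
  smooth := isSmoothForm_iff.1 hF.smooth
  nondegenerate_left := hF.nondegenerate_left
  nondegenerate_right := hF.nondegenerate_right

/-- The extra requirement that the lift be basic follows from the covector equation, by
`IsLinearDual.exists_lift`. -/
theorem isTDualAt_iff {c : Correspondence P Q} {v : GenTangent 𝓘(ℝ, EM) c.fst}
    {w : GenTangent 𝓘(ℝ, EM') c.snd} :
    IsTDualAt F c v w ↔ DualRel 𝓘(ℝ, EM) 𝓘(ℝ, EM') (Correspondence.fst : Correspondence P Q → M)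
      (Correspondence.snd : Correspondence P Q → M') F c v w := by
  constructor
  · rintro ⟨X, hX, h1, h2⟩
    exact ⟨X, hX.1, h1.symm, h2⟩
  · intro hr
    obtain ⟨X, hX, h1, h2⟩ := IsLinearDual.exists_lift hr
    exact ⟨X, hX, h1, h2⟩

/-- The Courant bracket of invariant sections is an invariant section. -/
theorem courantBracket_mem_invariantSections (P : PrincipalTorusBundle k EB EM B M)
    (hh : IsFlux k h) {v w : GenSection 𝓘(ℝ, EM) M}
    (hv : v ∈ invariantSections 𝓘(ℝ, EM) (Torus k) M)
    (hw : w ∈ invariantSections 𝓘(ℝ, EM) (Torus k) M) :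
    courantBracket 𝓘(ℝ, EM) h v w ∈ invariantSections 𝓘(ℝ, EM) (Torus k) M := by
  rw [mem_invariantSections_iff] at *
  refine ⟨IsSmoothSection.courantBracket (isSmoothForm_iff.1 hh.smooth) hv.1 hw.1, fun t => ?_⟩
  exact courantBracket_invariant (P.contMDiff_const_smul t) (hh.invariant t) hv.1 hw.1
    (hv.2 t).1 (hw.2 t).1 (hv.2 t).2 (hw.2 t).2

end TorusBundles

end TDuality

/-! ### Assembling the isomorphism -/

namespace TDuality

section Main

variable {k : ℕ}
  {EB : Type*} [NormedAddCommGroup EB] [NormedSpace ℝ EB]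
  {EM : Type*} [NormedAddCommGroup EM] [NormedSpace ℝ EM]
  {EM' : Type*} [NormedAddCommGroup EM'] [NormedSpace ℝ EM']
  {B : Type*} [TopologicalSpace B] [ChartedSpace EB B]
  {M : Type*} [TopologicalSpace M] [ChartedSpace EM M] [MulAction (Torus k) M]
  {M' : Type*} [TopologicalSpace M'] [ChartedSpace EM' M'] [MulAction (Torus k) M']
  {P : PrincipalTorusBundle k EB EM B M} {Q : PrincipalTorusBundle k EB EM' B M'}
  [IsManifold 𝓘(ℝ, EM) ∞ M] [IsManifold 𝓘(ℝ, EM') ∞ M']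
  [FiniteDimensional ℝ EM] [FiniteDimensional ℝ EM']
  {h : DForm 𝓘(ℝ, EM) M 3} {h' : DForm 𝓘(ℝ, EM') M' 3}
  {F : DForm (corrModel k EM) (Correspondence P Q) 2}

/-- The torus T^k × T^k supplies the symmetries: its first factor sweeps out the fibres over M'. -/
theorem IsTDuality.exists_dual (hF : IsTDuality h h' F) {v : GenSection 𝓘(ℝ, EM) M}
    (hv : v ∈ invariantSections 𝓘(ℝ, EM) (Torus k) M) :
    ∃ w ∈ invariantSections 𝓘(ℝ, EM') (Torus k) M',
      DualSections Correspondence.fst Correspondence.snd F v w :=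
  hF.isDualPair.exists_invariant_dual (act := fun s t c => (s, t) • c)
    (fun s t => Correspondence.contMDiff_const_smul (s, t)) (fun s t => smul_inv_smul (s, t))
    P.contMDiff_const_smul Q.contMDiff_const_smul (fun _ _ _ => rfl) (fun _ _ _ => rfl)
    (fun s t => hF.invariant (s, t)) (fun _ _ => Correspondence.exists_smul_eq_of_snd_eq) hv

theorem IsTDuality.exists_dual_symm (hF : IsTDuality h h' F) {w : GenSection 𝓘(ℝ, EM') M'}
    (hw : w ∈ invariantSections 𝓘(ℝ, EM') (Torus k) M') :
    ∃ v ∈ invariantSections 𝓘(ℝ, EM) (Torus k) M,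
      DualSections Correspondence.fst Correspondence.snd F v w := by
  -- With the projections exchanged, the two torus factors exchange roles as well.
  obtain ⟨v, hv, hvw⟩ := hF.isDualPair.symm.exists_invariant_dual
    (act := fun s t c => (t, s) • c)
    (fun s t => Correspondence.contMDiff_const_smul (t, s)) (fun s t => smul_inv_smul (t, s))
    Q.contMDiff_const_smul P.contMDiff_const_smul (fun _ _ _ => rfl) (fun _ _ _ => rfl)
    (fun s t => congrArg Neg.neg (hF.invariant (t, s)))
    (fun _ _ => Correspondence.exists_smul_eq_of_fst_eq) hw
  exact ⟨v, hv, dualSections_symm_iff.1 hvw⟩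

theorem IsTDuality.exists_linearEquiv (hF : IsTDuality h h' F) (c : Correspondence P Q) :
    ∃ φc : GenTangent 𝓘(ℝ, EM) c.fst ≃ₗ[ℝ] GenTangent 𝓘(ℝ, EM') c.snd,
      ∀ v w, φc v = w ↔ IsTDualAt F c v w := by
  have ht := hF.isDualPair.isDualTriple c
  refine exists_linearEquiv_of_relation ?_ ?_ ?_ ?_ ?_ ?_
  · intro v w v' w' h1 h2
    exact isTDualAt_iff.2 (IsLinearDual.add (isTDualAt_iff.1 h1) (isTDualAt_iff.1 h2))
  · intro r v w h1
    exact isTDualAt_iff.2 (IsLinearDual.smul r (isTDualAt_iff.1 h1))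
  · intro v
    obtain ⟨w, hw⟩ := ht.exists_dual v
    exact ⟨w, isTDualAt_iff.2 hw⟩
  · intro w
    obtain ⟨v, hv⟩ := ht.symm.exists_dual w
    exact ⟨v, isTDualAt_iff.2 (isLinearDual_symm_iff.1 hv)⟩
  · intro v w w' h1 h2
    exact (isTDualAt_iff.1 h1).unique ht (isTDualAt_iff.1 h2)
  · intro v v' w h1 h2
    exact (isTDualAt_iff.1 h1).symm.unique ht.symm (isTDualAt_iff.1 h2).symm

theorem IsTDualAt.pairing_eq {c : Correspondence P Q} {v₁ v₂ : GenTangent 𝓘(ℝ, EM) c.fst}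
    {w₁ w₂ : GenTangent 𝓘(ℝ, EM') c.snd} (h₁ : IsTDualAt F c v₁ w₁) (h₂ : IsTDualAt F c v₂ w₂) :
    pairing 𝓘(ℝ, EM') w₁ w₂ = pairing 𝓘(ℝ, EM) v₁ v₂ := by
  have e := (isTDualAt_iff.1 h₁).pairing_eq (isTDualAt_iff.1 h₂)
  exact congrArg (fun r : ℝ => 1 / 2 * r) e

theorem dualSections_iff {v : GenSection 𝓘(ℝ, EM) M} {w : GenSection 𝓘(ℝ, EM') M'} :
    DualSections Correspondence.fst Correspondence.snd F v w ↔
      ∀ c : Correspondence P Q, IsTDualAt F c (v c.fst) (w c.snd) :=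
  forall_congr' fun _ => isTDualAt_iff.symm

theorem IsTDuality.exists_linearEquiv_sections (hF : IsTDuality h h' F) :
    ∃ φ : invariantSections 𝓘(ℝ, EM) (Torus k) M ≃ₗ[ℝ] invariantSections 𝓘(ℝ, EM') (Torus k) M',
      ∀ v w, φ v = w ↔ DualSections Correspondence.fst Correspondence.snd F v.1 w.1 := by
  refine exists_linearEquiv_of_relation
    (V := invariantSections 𝓘(ℝ, EM) (Torus k) M) (W := invariantSections 𝓘(ℝ, EM') (Torus k) M')
    (R := fun v w => DualSections Correspondence.fst Correspondence.snd F v.1 w.1) ?_ ?_ ?_ ?_ ?_ ?_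
  · intro v w v' w' h1 h2 c
    exact IsLinearDual.add (h1 c) (h2 c)
  · intro r v w h1 c
    exact IsLinearDual.smul r (h1 c)
  · intro v
    obtain ⟨w, hw, hvw⟩ := hF.exists_dual v.2
    exact ⟨⟨w, hw⟩, hvw⟩
  · intro w
    obtain ⟨v, hv, hvw⟩ := hF.exists_dual_symm w.2
    exact ⟨⟨v, hv⟩, hvw⟩
  · intro v w w' h1 h2
    exact Subtype.ext (hF.isDualPair.dualSections_unique h1 h2)
  · intro v v' w h1 h2
    exact Subtype.ext (hF.isDualPair.symm.dualSections_unique (dualSections_symm_iff.2 h1)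
      (dualSections_symm_iff.2 h2))

/-- T-dual vectors have the same projection to the base. -/
theorem IsTDualAt.mfderiv_proj_eq [IsManifold 𝓘(ℝ, EB) ∞ B] {c : Correspondence P Q}
    {v : GenTangent 𝓘(ℝ, EM) c.fst} {w : GenTangent 𝓘(ℝ, EM') c.snd} (hc : IsTDualAt F c v w) :
    (mfderiv 𝓘(ℝ, EM') 𝓘(ℝ, EB) Q.proj c.snd w.1 : EB) =
      mfderiv 𝓘(ℝ, EM) 𝓘(ℝ, EB) P.proj c.fst v.1 := by
  obtain ⟨X, hX, hw, -⟩ := hc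
  -- Both vector parts come from one lift, and the two routes from the correspondence space to B
  -- agree.
  have e : Q.proj ∘ (Correspondence.snd : Correspondence P Q → M') =
      P.proj ∘ (Correspondence.fst : Correspondence P Q → M) := funext fun c => c.comm.symm
  have h1 := mfderiv_comp_apply c ((Q.contMDiff_proj c.snd).mdifferentiableAt (by simp))
    ((Correspondence.contMDiff_snd (P := P) c).mdifferentiableAt (by simp)) X
  have h2 := mfderiv_comp_apply c ((P.contMDiff_proj c.fst).mdifferentiableAt (by simp))
    ((Correspondence.contMDiff_fst (Q := Q) c).mdifferentiableAt (by simp)) X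
  rw [hw, ← hX.1]
  refine h1.symm.trans (Eq.trans ?_ h2)
  rw [e]

end Main

end TDuality

theorem mainTheorem1 (k : ℕ)
    {EB : Type*} [NormedAddCommGroup EB] [NormedSpace ℝ EB] [FiniteDimensional ℝ EB]
    {EM : Type*} [NormedAddCommGroup EM] [NormedSpace ℝ EM] [FiniteDimensional ℝ EM]
    {EM' : Type*} [NormedAddCommGroup EM'] [NormedSpace ℝ EM'] [FiniteDimensional ℝ EM']
    {B : Type*} [TopologicalSpace B] [T2Space B] [SecondCountableTopology B]
    [ChartedSpace EB B] [IsManifold 𝓘(ℝ, EB) ∞ B]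
    {M : Type*} [TopologicalSpace M] [T2Space M] [SecondCountableTopology M]
    [ChartedSpace EM M] [IsManifold 𝓘(ℝ, EM) ∞ M] [MulAction (Torus k) M]
    {M' : Type*} [TopologicalSpace M'] [T2Space M'] [SecondCountableTopology M']
    [ChartedSpace EM' M'] [IsManifold 𝓘(ℝ, EM') ∞ M'] [MulAction (Torus k) M']
    (P : PrincipalTorusBundle k EB EM B M) (Q : PrincipalTorusBundle k EB EM' B M')
    (h : DForm 𝓘(ℝ, EM) M 3) (h' : DForm 𝓘(ℝ, EM') M' 3)
    (hh : IsFlux k h) (hh' : IsFlux k h')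
    (F : DForm (corrModel k EM) (Correspondence P Q) 2) (hF : IsTDuality h h' F) :
    -- the lift used to define the map exists and is unique
    (∀ (c : Correspondence P Q) (v : GenTangent 𝓘(ℝ, EM) c.fst), ∃! X, IsBasicLift F c v X) ∧
    -- at every point of the correspondence space the map is a linear isometry
    (∀ c : Correspondence P Q,
      ∃ φc : GenTangent 𝓘(ℝ, EM) c.fst ≃ₗ[ℝ] GenTangent 𝓘(ℝ, EM') c.snd,
        (∀ v w, φc v = w ↔ IsTDualAt F c v w) ∧
        ∀ v₁ v₂, pairing 𝓘(ℝ, EM') (φc v₁) (φc v₂) = pairing 𝓘(ℝ, EM) v₁ v₂) ∧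
    -- it descends to an isomorphism `φ` between the spaces of invariant sections
    ∃ φ : invariantSections 𝓘(ℝ, EM) (Torus k) M ≃ₗ[ℝ] invariantSections 𝓘(ℝ, EM') (Torus k) M',
      (∀ v w, φ v = w ↔
        ∀ c : Correspondence P Q, IsTDualAt F c (v.1 c.fst) (w.1 c.snd)) ∧
      -- linear over smooth functions on `B`
      (∀ f : B → ℝ, ContMDiff 𝓘(ℝ, EB) 𝓘(ℝ, ℝ) ∞ f →
        ∀ v, ∃ u, (∀ m, u.1 m = f (P.proj m) • v.1 m) ∧
          ∀ m', (φ u).1 m' = f (Q.proj m') • (φ v).1 m') ∧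
      -- compatible with the projections to `TB`
      (∀ v, ∀ c : Correspondence P Q,
        (mfderiv 𝓘(ℝ, EM') 𝓘(ℝ, EB) Q.proj c.snd ((φ v).1 c.snd).1 : EB) =
          mfderiv 𝓘(ℝ, EM) 𝓘(ℝ, EB) P.proj c.fst (v.1 c.fst).1) ∧
      -- it preserves the pairing
      (∀ v₁ v₂, ∀ c : Correspondence P Q,
        pairing 𝓘(ℝ, EM) (v₁.1 c.fst) (v₂.1 c.fst) =
          pairing 𝓘(ℝ, EM') ((φ v₁).1 c.snd) ((φ v₂).1 c.snd)) ∧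
      -- and the twisted Courant brackets
      (∀ v₁ v₂, ∃ u, u.1 = courantBracket 𝓘(ℝ, EM) h v₁.1 v₂.1 ∧
        (φ u).1 = courantBracket 𝓘(ℝ, EM') h' (φ v₁).1 (φ v₂).1) := by
  obtain ⟨φ, hφ⟩ := hF.exists_linearEquiv_sections
  have hφt (v) : ∀ c : Correspondence P Q, IsTDualAt F c (v.1 c.fst) ((φ v).1 c.snd) :=
    dualSections_iff.1 ((hφ v _).1 rfl)
  refine ⟨fun c => (hF.isDualPair.isDualTriple c).existsUnique_lift, fun c => ?_, φ,
    fun v w => (hφ v w).trans dualSections_iff, fun f hf v => ?_,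
    fun v c => (hφt v c).mfderiv_proj_eq,
    fun v₁ v₂ c => ((hφt v₁ c).pairing_eq (hφt v₂ c)).symm, fun v₁ v₂ => ?_⟩
  · obtain ⟨φc, hφc⟩ := hF.exists_linearEquiv c
    exact ⟨φc, hφc, fun v₁ v₂ => ((hφc v₁ _).1 rfl).pairing_eq ((hφc v₂ _).1 rfl)⟩
  · have h1 := smul_mem_invariantSections (f := fun m => f (P.proj m)) (hf.comp P.contMDiff_proj)
      (fun t m => by rw [P.proj_smul]) v.2
    have h2 := smul_mem_invariantSections (f := fun m => f (Q.proj m)) (hf.comp Q.contMDiff_proj)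
      (fun t m => by rw [Q.proj_smul]) (φ v).2
    refine ⟨⟨_, h1⟩, fun _ => rfl, fun m' => ?_⟩
    -- The factors f ∘ P.proj and f ∘ Q.proj agree on the correspondence space, so scaling preserves
    -- duality and the characterization of φ gives the equation.
    have e : φ ⟨_, h1⟩ = ⟨_, h2⟩ := (hφ _ _).2
      (DualSections.smul (f := fun m => f (P.proj m)) (f' := fun m => f (Q.proj m))
        (fun c : Correspondence P Q => congrArg f c.comm) ((hφ v _).1 rfl))
    rw [e]
  · have h1 := courantBracket_mem_invariantSections P hh v₁.2 v₂.2
    have h2 := courantBracket_mem_invariantSections Q hh' (φ v₁).2 (φ v₂).2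
    -- Since both brackets are invariant sections, the equation reduces to their being dual at every
    -- point.
    refine ⟨⟨_, h1⟩, rfl, congrArg Subtype.val ((hφ ⟨_, h1⟩ ⟨_, h2⟩).2 ?_)⟩
    exact DualSections.courantBracket hF.isDualPair hF.sub_eq_deriv
      (mem_invariantSections_iff.1 v₁.2).1 (mem_invariantSections_iff.1 v₂.2).1
      ((hφ v₁ _).1 rfl) ((hφ v₂ _).1 rfl)
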